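/- Let $N\ge 1$, let $\Omega\subset\mathbb R^2$ be a bounded open set, and let $A=(A^{\alpha\beta})_{1\le\alpha,\beta\le 2}$, $A^{\alpha\beta}(y)\in M_N(\mathbb R)$, be a $\mathbb Z^2$-periodic family of class $C^\infty$ on $\mathbb R^2$ for which there is $\lambda>0$ with $$\lambda\,\xi^\alpha\cdot\xi^\alpha\le A^{\alpha\beta}_{ij}(y)\,\xi^\alpha_i\xi^\beta_j\le\lambda^{-1}\xi^\alpha\cdot\xi^\alpha\qquad\text{for all } y\in\mathbb R^2,\ \xi=(\xi^1,\xi^2)\in\mathbb R^N\times\mathbb R^N$$ (repeated indices are summed; $A$ need not be symmetric). For a tensor field $B$ write $(\nabla\cdot B\nabla v)_i=\partial_\alpha(B^{\alpha\beta}_{ij}\partial_\beta v_j)$. Let $\chi=(\chi^\gamma)_{1\le\gamma\le2}$, $\chi^\gamma(y)\in M_N(\mathbb R)$, be the periodic (classical) solution of the cell problem $$-\partial_{\alpha}\bigl(A^{\alpha\beta}\partial_{\beta}\chi^\gamma\bigr)=\partial_{\alpha}A^{\alpha\gamma}\ \text{ on }\mathbb T^2=\mathbb R^2/\mathbb Z^2,\qquad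 \int_{\mathbb T^2}\chi^\gamma\,dy=0,$$ and let $A^{0}$ be the constant homogenized tensor $A^{0,\alpha\beta}=\int_{\mathbb T^2}A^{\alpha\beta}\,dy+\int_{\mathbb T^2}A^{\alpha\gamma}\partial_{\gamma}\chi^\beta\,dy$. Then there is a constant $C>0$, depending only on $N$, $\Omega$ and $A$, with the following property. Let $f\in H^{-1}(\Omega;\mathbb R^N)$, let $\varphi_0\in H^1(\Omega;\mathbb R^N)$ represent the boundary data, let $\varepsilon>0$, and let $u^0,u^\varepsilon\in H^1(\Omega;\mathbb R^N)$ be weak solutions of $$-\nabla\cdot A^0\nabla u^0=f\ \text{ in }\Omega,\quad u^0=\varphi_0\ \text{ on }\partial\Omega,\qquad\qquad -\nabla\cdot A\bigl(\tfrac{x}{\varepsilon}\bigr)\nabla u^\varepsilon=f\ \text{ in }\Omega,\quad u^\varepsilon=\varphi_0\ \text{ on }\partial\Omega,$$ where an equality $v=g$ on $\partial\Omega$ means $v-g\in H^1_0(\Omega;\mathbb R^N)$. Assume that $u^0\in H^2(\Omega;\mathbb R^N)$, put $u^1(x,y)=\chi^\alpha(y)\,\partial_{x_\alpha}u^0(x)$,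 and let $\vartheta^\varepsilon_{u,bl}\in H^1(\Omega;\mathbb R^N)$ be the weak solution of $$-\nabla\cdot A\bigl(\tfrac{x}{\varepsilon}\bigr)\nabla\vartheta^\varepsilon_{u,bl}=0\ \text{ in }\Omega,\qquad \vartheta^\varepsilon_{u,bl}=-u^1\bigl(x,\tfrac{x}{\varepsilon}\bigr)\ \text{ on }\partial\Omega.$$ Then $u^\varepsilon-u^0-\varepsilon u^1(\cdot,\frac{\cdot}{\varepsilon})-\varepsilon\vartheta^\varepsilon_{u,bl}$ belongs to $H^1(\Omega;\mathbb R^N)$ and $$\Bigl\|u^\varepsilon(x)-u^0(x)-\varepsilon u^1\bigl(x,\tfrac{x}{\varepsilon}\bigr)-\varepsilon\vartheta^\varepsilon_{u,bl}(x)\Bigr\|_{H^1(\Omega)}\le C\,\varepsilon\,\|u^0\|_{H^2(\Omega)}.$$ -/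

import Mathlib

open MeasureTheory TopologicalSpace
open scoped Distributions ContDiff

noncomputable section

namespace Homogenization

/-- The Euclidean plane `ℝ²`. -/
abbrev Plane := EuclideanSpace ℝ (Fin 2)

/-- The space of values `ℝᴺ`, with its Euclidean norm. -/
abbrev Vec (N : ℕ) := EuclideanSpace ℝ (Fin N)

/-- Coefficient families `y ↦ A^{αβ}(y) ∈ M_N(ℝ)`, `α, β ∈ {1, 2}`; the entry `A^{αβ}_{ij}(y)` is
`A y α β i j`. -/
abbrev Coeff (N : ℕ) := Plane → Fin 2 → Fin 2 → Matrix (Fin N) (Fin N) ℝ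

/-- The classical partial derivative `∂_α f` on the plane. -/
def pd {F : Type*} [NormedAddCommGroup F] [NormedSpace ℝ F]
    (α : Fin 2) (f : Plane → F) (x : Plane) : F :=
  fderiv ℝ f x (EuclideanSpace.single α 1)

/-! ### Sobolev spaces on an open set

Functions on `Ω` are represented by functions on the plane; only their values on `Ω` matter. -/

/-- `u` and `g` are in `L²(Ω)` and `g = ∂_α u` weakly in `Ω`. -/
structure HasWeakDeriv {N : ℕ} (Ω : Opens Plane) (α : Fin 2) (u g : Plane → Vec N) : Prop where
  memLp : MemLp u 2 (volume.restrict (Ω : Set Plane))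
  memLp_deriv : MemLp g 2 (volume.restrict (Ω : Set Plane))
  integral_eq : ∀ φ : 𝓓(Ω, ℝ),
    ∫ x in (Ω : Set Plane), pd α φ x • u x = -∫ x in (Ω : Set Plane), φ x • g x

open Classical in
/-- The weak derivative `∂_α u` in `L²(Ω)` (unique up to a null subset of `Ω`); it is `0` if there
is none. -/
def weakDeriv {N : ℕ} (Ω : Opens Plane) (α : Fin 2) (u : Plane → Vec N) : Plane → Vec N :=
  if h : ∃ g, HasWeakDeriv Ω α u g then h.choose else 0

/-- `u ∈ H¹(Ω; ℝᴺ)`. -/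
def MemH1 {N : ℕ} (Ω : Opens Plane) (u : Plane → Vec N) : Prop :=
  ∀ α : Fin 2, ∃ g, HasWeakDeriv Ω α u g

/-- `u ∈ H²(Ω; ℝᴺ)`. -/
def MemH2 {N : ℕ} (Ω : Opens Plane) (u : Plane → Vec N) : Prop :=
  MemH1 Ω u ∧ ∀ α : Fin 2, MemH1 Ω (weakDeriv Ω α u)

/-- The norm of `H¹(Ω; ℝᴺ)`. -/
def h1Norm {N : ℕ} (Ω : Opens Plane) (u : Plane → Vec N) : ℝ :=
  Real.sqrt ((∫ x in (Ω : Set Plane), ‖u x‖ ^ 2)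
    + ∑ α : Fin 2, ∫ x in (Ω : Set Plane), ‖weakDeriv Ω α u x‖ ^ 2)

/-- The norm of `H²(Ω; ℝᴺ)`. -/
def h2Norm {N : ℕ} (Ω : Opens Plane) (u : Plane → Vec N) : ℝ :=
  Real.sqrt ((∫ x in (Ω : Set Plane), ‖u x‖ ^ 2)
    + (∑ α : Fin 2, ∫ x in (Ω : Set Plane), ‖weakDeriv Ω α u x‖ ^ 2)
    + ∑ α : Fin 2, ∑ β : Fin 2,
        ∫ x in (Ω : Set Plane), ‖weakDeriv Ω α (weakDeriv Ω β u) x‖ ^ 2)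

/-- `u ∈ H¹₀(Ω; ℝᴺ)`, the closure of the test functions in `H¹(Ω; ℝᴺ)`. -/
def MemH10 {N : ℕ} (Ω : Opens Plane) (u : Plane → Vec N) : Prop :=
  MemH1 Ω u ∧ ∀ δ : ℝ, 0 < δ → ∃ φ : 𝓓(Ω, Vec N), h1Norm Ω (fun x => u x - φ x) < δ

/-- `f ∈ H⁻¹(Ω; ℝᴺ)`: a bounded linear functional on `H¹₀(Ω; ℝᴺ)`. (Linearity and boundedness
force `f` to take the same value on functions which agree almost everywhere in `Ω`.) -/
structure MemHMinusOne {N : ℕ} (Ω : Opens Plane) (f : (Plane → Vec N) → ℝ) : Prop where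
  map_add : ∀ v w, MemH10 Ω v → MemH10 Ω w → f (v + w) = f v + f w
  map_smul : ∀ (c : ℝ) (v), MemH10 Ω v → f (c • v) = c * f v
  bound : ∃ K : ℝ, ∀ v, MemH10 Ω v → |f v| ≤ K * h1Norm Ω v

/-! ### Elliptic systems -/

/-- The bilinear form `∫_Ω B^{αβ}_{ij} ∂_β u_j ∂_α v_i` of the operator `-∇·B∇`. -/
def energyForm {N : ℕ} (Ω : Opens Plane) (B : Coeff N) (u v : Plane → Vec N) : ℝ :=
  ∫ x in (Ω : Set Plane), ∑ α : Fin 2, ∑ β : Fin 2, ∑ i : Fin N, ∑ j : Fin N,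
    B x α β i j * weakDeriv Ω β u x j * weakDeriv Ω α v x i

/-- `u ∈ H¹(Ω)` is a weak solution of `-∇·B∇u = f` in `Ω`, `u = g` on `∂Ω`. The boundary data are
given by a function `g ∈ H¹(Ω)`, and the boundary condition means `u - g ∈ H¹₀(Ω)`. -/
structure IsWeakSolution {N : ℕ} (Ω : Opens Plane) (B : Coeff N) (f : (Plane → Vec N) → ℝ)
    (g u : Plane → Vec N) : Prop where
  memH1 : MemH1 Ω u
  boundary : MemH10 Ω (fun x => u x - g x)
  weak : ∀ v, MemH10 Ω v → energyForm Ω B u v = f v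

/-! ### Periodic coefficients, cell problem, homogenized tensor -/

/-- Ellipticity: `λ ξ^α·ξ^α ≤ A^{αβ}_{ij} ξ^α_i ξ^β_j ≤ λ⁻¹ ξ^α·ξ^α`. -/
def IsElliptic {N : ℕ} (A : Coeff N) : Prop :=
  ∃ lam : ℝ, 0 < lam ∧ ∀ (y : Plane) (ξ : Fin 2 → Vec N),
    lam * ∑ α, ‖ξ α‖ ^ 2 ≤ ∑ α, ∑ β, ∑ i, ∑ j, A y α β i j * ξ α i * ξ β j ∧
    ∑ α, ∑ β, ∑ i, ∑ j, A y α β i j * ξ α i * ξ β j ≤ lam⁻¹ * ∑ α, ‖ξ α‖ ^ 2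

/-- The point of the plane with integer coordinates `h`. -/
def latticePoint (h : Fin 2 → ℤ) : Plane := WithLp.toLp 2 (fun k => (h k : ℝ))

/-- `ℤ²`-periodicity. -/
def IsPeriodic {F : Type*} (f : Plane → F) : Prop :=
  ∀ (y : Plane) (h : Fin 2 → ℤ), f (y + latticePoint h) = f y

/-- All the entries `A^{αβ}_{ij}` are of class `C^∞`. -/
def IsSmoothCoeff {N : ℕ} (A : Coeff N) : Prop :=
  ∀ α β i j, ContDiff ℝ ∞ (fun y => A y α β i j)

/-- The unit cell `[0,1)²`, a fundamental domain of the torus `𝕋² = ℝ²/ℤ²`. -/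
def unitCell : Set Plane := {y | ∀ k, y k ∈ Set.Ico (0 : ℝ) 1}

/-- `χ = (χ^γ)` is the (classical) periodic solution with zero mean of the cell problem
`-∂_α (A^{αβ} ∂_β χ^γ) = ∂_α A^{αγ}` on `𝕋²`. -/
structure IsCellCorrector {N : ℕ} (A : Coeff N)
    (χ : Fin 2 → Plane → Matrix (Fin N) (Fin N) ℝ) : Prop where
  contDiff : ∀ γ i j, ContDiff ℝ 2 (fun y => χ γ y i j)
  periodic : ∀ γ, IsPeriodic (χ γ)
  equation : ∀ γ i j y,
    -∑ α, pd α (fun z => ∑ β, ∑ k, A z α β i k * pd β (fun t => χ γ t k j) z) y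
      = ∑ α, pd α (fun z => A z α γ i j) y
  mean_zero : ∀ γ i j, ∫ y in unitCell, χ γ y i j = 0

/-- The homogenized tensor `A^{0,αβ} = ∫_{𝕋²} A^{αβ} + ∫_{𝕋²} A^{αγ} ∂_γ χ^β`, as a constant
coefficient family. -/
def homogenized {N : ℕ} (A : Coeff N) (χ : Fin 2 → Plane → Matrix (Fin N) (Fin N) ℝ) :
    Coeff N := fun _ α β i j =>
  (∫ y in unitCell, A y α β i j)
    + ∫ y in unitCell, ∑ γ, ∑ k, A y α γ i k * pd γ (fun z => χ β z k j) y

/-- The oscillating coefficients `A^ε(x) = A(x/ε)`. -/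
def oscillating {N : ℕ} (A : Coeff N) (ε : ℝ) : Coeff N := fun x => A (ε⁻¹ • x)

/-- The first-order corrector `x ↦ u¹(x, x/ε)`, where `u¹(x,y) = χ^α(y) ∂_α u⁰(x)`. -/
def firstCorrector {N : ℕ} (Ω : Opens Plane) (χ : Fin 2 → Plane → Matrix (Fin N) (Fin N) ℝ)
    (ε : ℝ) (u₀ : Plane → Vec N) : Plane → Vec N := fun x =>
  ∑ α : Fin 2, WithLp.toLp 2 ((χ α (ε⁻¹ • x)).mulVec (weakDeriv Ω α u₀ x).ofLp)

end Homogenization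

end

open MeasureTheory TopologicalSpace
open scoped Distributions ContDiff

noncomputable section

namespace Homogenization

/-! ### Weak derivatives -/

section WeakDerivatives

variable {N : ℕ} {Ω : Opens Plane} {α : Fin 2} {u v g h : Plane → Vec N}

/-! Let `r` be the remainder. The boundary data of `u` and `u₀` coincide and `ϑ` cancels the trace
of the first corrector, so `r` lies in `H¹₀` (`memH10_remainder`); it therefore suffices to bound
its energy. The two equations share the right-hand side `f`. Tested with `∇φ`, the flux of `r` thus
equals `A⁰∇u₀ - A(x/ε)∇u₀ - εA(x/ε)∇(u¹(x, x/ε))`. The factor `ε⁻¹` produced by differentiating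
`χ(x/ε)` cancels the `ε` in front, and what remains (`flux_homogenized_sub`) is `-b(x/ε)∇u₀`, with
`b = A + A∂χ - A⁰`, together with a term of order `ε` in `D²u₀`. The first term looks of order one,
but `b` is special: the cell problem says that its columns are divergence free, and the definition
of `A⁰` says that they have mean zero. In the plane such a periodic field is the rotated gradient of
a periodic, hence bounded, stream function `Ψ` (`exists_stream_function`). So `b(x/ε)` is `ε` times
the rotated gradient of `Ψ(x/ε)`. Rotated gradients are orthogonal to gradients of test functions,
so after integration by parts the only derivatives left fall on `∂u₀`, and the factor `ε` is gained
(`pairing_fluxCorrector`). Consequently `-∇·A(x/ε)∇r = -ε∇·F`, where `F` is a bounded coefficient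
field, uniformly in `ε`, applied to `D²u₀` (`energyForm_remainder`). Density allows testing with `r`
itself; coercivity gives `‖∇r‖ ≤ Cε‖u₀‖_{H²}`, and Poincaré's inequality (`exists_poincare`)
upgrades this to the `H¹` norm. No regularity of the boundary enters. -/

lemma integrable_smul_of_memLp_two {X E : Type*} [MeasurableSpace X] [NormedAddCommGroup E]
    [NormedSpace ℝ E] {μ : Measure X} {φ : X → ℝ} {f : X → E}
    (hφ : MemLp φ 2 μ) (hf : MemLp f 2 μ) : Integrable (fun x => φ x • f x) μ := by
  rw [← memLp_one_iff_integrable]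
  exact hf.smul hφ

lemma memLp_of_continuous_hasCompactSupport {E : Type*} [NormedAddCommGroup E]
    {f : Plane → E} (hf : Continuous f) (hc : HasCompactSupport f) (Ω : Set Plane) :
    MemLp f 2 (volume.restrict Ω) :=
  (hf.memLp_of_hasCompactSupport hc).restrict Ω

lemma continuous_pd {F : Type*} [NormedAddCommGroup F] [NormedSpace ℝ F] {f : Plane → F}
    {n : WithTop ℕ∞} (hf : ContDiff ℝ n f) (hn : n ≠ 0) (α : Fin 2) : Continuous (pd α f) :=
  (hf.continuous_fderiv hn).clm_apply continuous_const

lemma hasCompactSupport_pd {F : Type*} [NormedAddCommGroup F] [NormedSpace ℝ F] {f : Plane → F}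
    (hf : HasCompactSupport f) (α : Fin 2) : HasCompactSupport (pd α f) :=
  hf.fderiv_apply (𝕜 := ℝ) _

lemma contDiff_pd {F : Type*} [NormedAddCommGroup F] [NormedSpace ℝ F] {f : Plane → F}
    {n m : WithTop ℕ∞} (hf : ContDiff ℝ n f) (hmn : m + 1 ≤ n) (α : Fin 2) :
    ContDiff ℝ m (pd α f) :=
  (hf.fderiv_right hmn).clm_apply contDiff_const

lemma tsupport_pd_subset {F : Type*} [NormedAddCommGroup F] [NormedSpace ℝ F] (f : Plane → F)
    (α : Fin 2) : tsupport (pd α f) ⊆ tsupport f :=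
  tsupport_fderiv_apply_subset ℝ _

lemma pd_mul {f k : Plane → ℝ} {x : Plane} (hf : DifferentiableAt ℝ f x)
    (hk : DifferentiableAt ℝ k x) (α : Fin 2) :
    pd α (fun y => f y * k y) x = pd α f x * k x + f x * pd α k x := by
  simp only [pd]
  rw [fderiv_fun_mul hf hk]
  simp [mul_comm]
  ring

lemma pd_apply_coord {f : Plane → Vec N} {x : Plane} (hf : DifferentiableAt ℝ f x) (α : Fin 2)
    (i : Fin N) : pd α (fun y => f y i) x = pd α f x i := by
  have := ((EuclideanSpace.proj (𝕜 := ℝ) i).hasFDerivAt.comp x hf.hasFDerivAt).fderiv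
  simp only [pd]
  change fderiv ℝ ((EuclideanSpace.proj (𝕜 := ℝ) i) ∘ f) x _ = _
  rw [this]
  rfl

lemma pd_comp_smul {f : Plane → ℝ} (hf : Differentiable ℝ f) (c : ℝ) (α : Fin 2) (x : Plane) :
    pd α (fun y => f (c • y)) x = c * pd α f (c • x) := by
  have h1 : HasFDerivAt (fun y : Plane => c • y) (c • ContinuousLinearMap.id ℝ Plane) x :=
    (hasFDerivAt_id x).const_smul c
  have := ((hf (c • x)).hasFDerivAt.comp x h1).fderiv
  simp only [pd]
  change fderiv ℝ (f ∘ fun y : Plane => c • y) x _ = _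
  rw [this]
  simp

/-! ### Linearity and uniqueness of weak derivatives. -/

lemma HasWeakDeriv.sub (hu : HasWeakDeriv Ω α u g) (hv : HasWeakDeriv Ω α v h) :
    HasWeakDeriv Ω α (fun x => u x - v x) (fun x => g x - h x) where
  memLp := hu.memLp.sub hv.memLp
  memLp_deriv := hu.memLp_deriv.sub hv.memLp_deriv
  integral_eq φ := by
    have h1 := memLp_of_continuous_hasCompactSupport φ.continuous φ.hasCompactSupport Ω
    have h2 := memLp_of_continuous_hasCompactSupport (continuous_pd φ.contDiff (by simp) α)
      (hasCompactSupport_pd φ.hasCompactSupport α) Ω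
    simp only [smul_sub]
    rw [integral_sub (integrable_smul_of_memLp_two h2 hu.memLp)
      (integrable_smul_of_memLp_two h2 hv.memLp),
      integral_sub (integrable_smul_of_memLp_two h1 hu.memLp_deriv)
      (integrable_smul_of_memLp_two h1 hv.memLp_deriv), hu.integral_eq, hv.integral_eq]
    abel

lemma HasWeakDeriv.const_smul (hu : HasWeakDeriv Ω α u g) (c : ℝ) :
    HasWeakDeriv Ω α (fun x => c • u x) (fun x => c • g x) where
  memLp := hu.memLp.const_smul c
  memLp_deriv := hu.memLp_deriv.const_smul c
  integral_eq φ := by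
    simp only [smul_comm _ c]
    rw [integral_smul, integral_smul, hu.integral_eq, smul_neg]

/-- The difference is a weak derivative of `u - u = 0`, so it integrates to zero against every test
function, and the fundamental lemma of the calculus of variations applies. This frees later
arguments from the choice made in `weakDeriv`. -/
lemma HasWeakDeriv.ae_eq (hu : HasWeakDeriv Ω α u g) (hv : HasWeakDeriv Ω α u h) :
    g =ᵐ[volume.restrict (Ω : Set Plane)] h := by
  have h0 := hu.sub hv
  have key := Ω.isOpen.ae_eq_zero_of_integral_contDiff_smul_eq_zero (μ := volume)
    (f := fun x => g x - h x) ?_ ?_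
  · refine (ae_restrict_iff' Ω.isOpen.measurableSet).2 ?_
    filter_upwards [key] with x hx hxΩ using sub_eq_zero.1 (hx hxΩ)
  · exact locallyIntegrableOn_of_locallyIntegrable_restrict
      (h0.memLp_deriv.locallyIntegrable (by norm_num))
  · intro φ hφ hc hs
    have := h0.integral_eq ⟨φ, hφ, hc, hs⟩
    simp only [sub_self, smul_zero, integral_zero, TestFunction.coe_mk] at this
    rw [← setIntegral_eq_integral_of_forall_compl_eq_zero (s := (Ω : Set Plane))]
    · exact neg_eq_zero.1 this.symm
    · intro x hx
      rw [image_eq_zero_of_notMem_tsupport (fun h => hx (hs h)), zero_smul]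

lemma MemH1.hasWeakDeriv (hu : MemH1 Ω u) (α : Fin 2) : HasWeakDeriv Ω α u (weakDeriv Ω α u) := by
  have := hu α
  rw [weakDeriv, dif_pos this]
  exact this.choose_spec

lemma HasWeakDeriv.weakDeriv_ae_eq (hu : HasWeakDeriv Ω α u g) :
    weakDeriv Ω α u =ᵐ[volume.restrict (Ω : Set Plane)] g := by
  have : ∃ g, HasWeakDeriv Ω α u g := ⟨g, hu⟩
  rw [weakDeriv, dif_pos this]
  exact this.choose_spec.ae_eq hu

lemma MemH1.memLp (hu : MemH1 Ω u) : MemLp u 2 (volume.restrict (Ω : Set Plane)) :=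
  (hu 0).choose_spec.memLp

lemma MemH1.memLp_weakDeriv (hu : MemH1 Ω u) (α : Fin 2) :
    MemLp (weakDeriv Ω α u) 2 (volume.restrict (Ω : Set Plane)) :=
  (hu.hasWeakDeriv α).memLp_deriv

lemma MemH1.sub (hu : MemH1 Ω u) (hv : MemH1 Ω v) : MemH1 Ω (fun x => u x - v x) :=
  fun α => ⟨_, (hu.hasWeakDeriv α).sub (hv.hasWeakDeriv α)⟩

lemma MemH1.const_smul (hu : MemH1 Ω u) (c : ℝ) : MemH1 Ω (fun x => c • u x) :=
  fun α => ⟨_, (hu.hasWeakDeriv α).const_smul c⟩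

lemma MemH1.weakDeriv_sub (hu : MemH1 Ω u) (hv : MemH1 Ω v) (α : Fin 2) :
    weakDeriv Ω α (fun x => u x - v x) =ᵐ[volume.restrict (Ω : Set Plane)]
      fun x => weakDeriv Ω α u x - weakDeriv Ω α v x :=
  ((hu.hasWeakDeriv α).sub (hv.hasWeakDeriv α)).weakDeriv_ae_eq

lemma MemH1.weakDeriv_const_smul (hu : MemH1 Ω u) (c : ℝ) (α : Fin 2) :
    weakDeriv Ω α (fun x => c • u x) =ᵐ[volume.restrict (Ω : Set Plane)]
      fun x => c • weakDeriv Ω α u x :=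
  ((hu.hasWeakDeriv α).const_smul c).weakDeriv_ae_eq

lemma integral_pd_smul_eq {φ : Plane → ℝ} {f : Plane → Vec N} (hφ : ContDiff ℝ 1 φ)
    (hf : ContDiff ℝ 1 f) (hφc : HasCompactSupport φ) (hfc : HasCompactSupport f) (α : Fin 2) :
    ∫ x, pd α φ x • f x = -∫ x, φ x • pd α f x := by
  have hφ' := continuous_pd hφ one_ne_zero α
  have hf' := continuous_pd hf one_ne_zero α
  rw [eq_neg_iff_add_eq_zero, ← eq_neg_iff_add_eq_zero.1
    (integral_smul_fderiv_eq_neg_fderiv_smul_of_integrable (μ := volume)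
    (v := EuclideanSpace.single α (1 : ℝ)) (f := φ) (g := f) ?_ ?_ ?_
    (fun x _ => (hφ.differentiable one_ne_zero) x)
    (fun x _ => (hf.differentiable one_ne_zero) x)), add_comm]
  · rfl
  · exact (hφ'.smul hf.continuous).integrable_of_hasCompactSupport hfc.smul_left
  · exact (hφ.continuous.smul hf').integrable_of_hasCompactSupport hφc.smul_right
  · exact (hφ.continuous.smul hf.continuous).integrable_of_hasCompactSupport hφc.smul_right

lemma setIntegral_eq_integral_of_tsupport_subset {E F : Type*} [NormedAddCommGroup E]
    [NormedSpace ℝ E] [NormedAddCommGroup F] {s : Set Plane} {φ : Plane → F} {f : Plane → E}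
    (hs : tsupport φ ⊆ s)
    (hf : ∀ x, φ x = 0 → f x = 0) : ∫ x in s, f x = ∫ x, f x :=
  setIntegral_eq_integral_of_forall_compl_eq_zero fun _ hx =>
    hf _ (image_eq_zero_of_notMem_tsupport fun h => hx (hs h))

lemma hasWeakDeriv_testFunction (φ : 𝓓(Ω, Vec N)) (α : Fin 2) : HasWeakDeriv Ω α φ (pd α φ) where
  memLp := memLp_of_continuous_hasCompactSupport φ.continuous φ.hasCompactSupport Ω
  memLp_deriv := memLp_of_continuous_hasCompactSupport (continuous_pd φ.contDiff (by simp) α)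
      (hasCompactSupport_pd φ.hasCompactSupport α) Ω
  integral_eq ψ := by
    rw [setIntegral_eq_integral_of_tsupport_subset ((tsupport_pd_subset _ α).trans
      ψ.tsupport_subset) (fun x hx => by rw [hx, zero_smul]),
      setIntegral_eq_integral_of_tsupport_subset ψ.tsupport_subset
        (fun x hx => by rw [hx, zero_smul])]
    exact integral_pd_smul_eq (ψ.contDiff.of_le (by simp)) (φ.contDiff.of_le (by simp))
      ψ.hasCompactSupport φ.hasCompactSupport α

lemma memH1_testFunction (φ : 𝓓(Ω, Vec N)) : MemH1 Ω φ :=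
  fun α => ⟨_, hasWeakDeriv_testFunction φ α⟩

/-! ### Testing against compactly supported functions of class `C¹` -/

open ContinuousLinearMap in
/-- A compactly supported function of class `C¹` is a uniform limit of test functions, together
with its partial derivatives. -/
lemma exists_testFunction_approx {φ : Plane → ℝ} (hφ : ContDiff ℝ 1 φ)
    (hc : HasCompactSupport φ) (hs : tsupport φ ⊆ Ω) (α : Fin 2) {δ : ℝ} (hδ : 0 < δ) :
    ∃ ψ : 𝓓(Ω, ℝ), ∀ x, |ψ x - φ x| ≤ δ ∧ |pd α ψ x - pd α φ x| ≤ δ := by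
  obtain ⟨r, hr, hrΩ⟩ := hc.isCompact.exists_cthickening_subset_open Ω.isOpen hs
  have huc1 := hφ.continuous.uniformContinuous_of_tendsto_cocompact hc.is_zero_at_infty
  have hcont := continuous_pd hφ one_ne_zero α
  have huc2 := hcont.uniformContinuous_of_tendsto_cocompact
    (hasCompactSupport_pd hc α).is_zero_at_infty
  obtain ⟨r1, hr1, h1⟩ := Metric.uniformContinuous_iff.1 huc1 δ hδ
  obtain ⟨r2, hr2, h2⟩ := Metric.uniformContinuous_iff.1 huc2 δ hδ
  -- One mollification radius serves three purposes: `r` keeps the support inside `Ω`, while `r1`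
  -- and `r2` are moduli of uniform continuity for `φ` and its derivative.
  set R := min r (min r1 r2) with hR
  have hR0 : 0 < R := by positivity
  let ρ : ContDiffBump (0 : Plane) := ⟨R / 2, R, by linarith, by linarith⟩
  have hρc : HasCompactSupport (ρ.normed volume) := ρ.hasCompactSupport_normed
  have hρs : ContDiff ℝ ((⊤ : ℕ∞) : WithTop ℕ∞) (ρ.normed volume) := ρ.contDiff_normed
  have hρi : LocallyIntegrable (ρ.normed volume) (volume : Measure Plane) :=
    hρs.continuous.locallyIntegrable
  let ψ := convolution (ρ.normed volume) φ (lsmul ℝ ℝ) volume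
  have hψ : ContDiff ℝ ((⊤ : ℕ∞) : WithTop ℕ∞) ψ :=
    hρc.contDiff_convolution_left _ hρs hφ.continuous.locallyIntegrable
  -- The derivative can be put on `φ`, so `pd α ψ` is itself a mollification of `pd α φ`.
  have hψpd : ∀ x, pd α ψ x = convolution (ρ.normed volume) (pd α φ) (lsmul ℝ ℝ) volume x := by
    intro x
    have := (hc.hasFDerivAt_convolution_right (lsmul ℝ ℝ) (μ := volume) hρi hφ x).fderiv
    simp only [pd]
    change fderiv ℝ (convolution (ρ.normed volume) φ (lsmul ℝ ℝ) volume) x _ = _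
    rw [this, convolution_precompR_apply _ hρi (hc.fderiv ℝ) (hφ.continuous_fderiv one_ne_zero)]
    rfl
  have hsupp : tsupport ψ ⊆ Metric.cthickening r (tsupport φ) := by
    refine closure_minimal ?_ Metric.isClosed_cthickening
    refine (support_convolution_subset_swap _).trans ?_
    rintro x ⟨a, ha, b, hb, rfl⟩
    rw [ρ.support_normed_eq, mem_ball_zero_iff] at hb
    refine Metric.mem_cthickening_of_dist_le _ a r _ (subset_tsupport _ ha) ?_
    simp only [dist_eq_norm, add_sub_cancel_left]
    exact hb.le.trans (min_le_left _ _)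
  refine ⟨⟨ψ, hψ, ?_, hsupp.trans hrΩ⟩, fun x => ⟨?_, ?_⟩⟩
  · exact HasCompactSupport.of_support_subset_isCompact hc.isCompact.cthickening
      ((subset_tsupport _).trans hsupp)
  · rw [TestFunction.coe_mk, ← Real.dist_eq]
    refine ρ.dist_normed_convolution_le hφ.continuous.aestronglyMeasurable fun y hy => (h1 ?_).le
    exact lt_of_lt_of_le hy ((min_le_right _ _).trans (min_le_left _ _))
  · rw [TestFunction.coe_mk, hψpd, ← Real.dist_eq]
    refine ρ.dist_normed_convolution_le hcont.aestronglyMeasurable fun y hy => (h2 ?_).le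
    exact lt_of_lt_of_le hy ((min_le_right _ _).trans (min_le_right _ _))

lemma isFiniteMeasure_restrict_of_isBounded {s : Set Plane} (hs : Bornology.IsBounded s) :
    IsFiniteMeasure (volume.restrict s) :=
  ⟨by simpa using hs.measure_lt_top⟩

/-- Both sides are continuous under uniform convergence of `φ` and `pd α φ`, because `u` and `g` are
integrable on the bounded set `Ω`. The extension to `C¹` is needed since products with `χ` or `Ψ`
are not smooth test functions. -/
lemma HasWeakDeriv.integral_eq_of_contDiff_one (hΩ : Bornology.IsBounded (Ω : Set Plane))
    (hu : HasWeakDeriv Ω α u g) {φ : Plane → ℝ} (hφ : ContDiff ℝ 1 φ)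
    (hc : HasCompactSupport φ) (hs : tsupport φ ⊆ Ω) :
    ∫ x in (Ω : Set Plane), pd α φ x • u x = -∫ x in (Ω : Set Plane), φ x • g x := by
  have := isFiniteMeasure_restrict_of_isBounded hΩ
  have hui : Integrable u (volume.restrict (Ω : Set Plane)) := hu.memLp.integrable (by norm_num)
  have hgi : Integrable g (volume.restrict (Ω : Set Plane)) :=
    hu.memLp_deriv.integrable (by norm_num)
  have hφ2 := memLp_of_continuous_hasCompactSupport hφ.continuous hc Ω
  have hφ2' := memLp_of_continuous_hasCompactSupport (continuous_pd hφ one_ne_zero α)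
    (hasCompactSupport_pd hc α) Ω
  rw [← sub_eq_zero, sub_neg_eq_add, ← norm_le_zero_iff]
  set K := (∫ x in (Ω : Set Plane), ‖u x‖) + ∫ x in (Ω : Set Plane), ‖g x‖ with hK
  have hK0 : 0 ≤ K := add_nonneg (integral_nonneg fun _ => norm_nonneg _)
    (integral_nonneg fun _ => norm_nonneg _)
  refine le_of_forall_pos_le_add fun η hη => ?_
  -- The total error is at most `δ * K`; the `+ 1` avoids dividing by zero.
  have hδ : 0 < η / (K + 1) := by positivity
  obtain ⟨ψ, hψ⟩ := exists_testFunction_approx hφ hc hs α hδ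
  have hψ2 := memLp_of_continuous_hasCompactSupport ψ.continuous ψ.hasCompactSupport Ω
  have hψ2' := memLp_of_continuous_hasCompactSupport (continuous_pd ψ.contDiff (by simp) α)
      (hasCompactSupport_pd ψ.hasCompactSupport α) Ω
  have e := hu.integral_eq ψ
  have e1 : ∫ x in (Ω : Set Plane), (pd α φ x - pd α ψ x) • u x
      = (∫ x in (Ω : Set Plane), pd α φ x • u x) - ∫ x in (Ω : Set Plane), pd α ψ x • u x := by
    simp only [sub_smul]
    exact integral_sub (integrable_smul_of_memLp_two hφ2' hu.memLp)
      (integrable_smul_of_memLp_two hψ2' hu.memLp)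
  have e2 : ∫ x in (Ω : Set Plane), (φ x - ψ x) • g x
      = (∫ x in (Ω : Set Plane), φ x • g x) - ∫ x in (Ω : Set Plane), ψ x • g x := by
    simp only [sub_smul]
    exact integral_sub (integrable_smul_of_memLp_two hφ2 hu.memLp_deriv)
      (integrable_smul_of_memLp_two hψ2 hu.memLp_deriv)
  have e3 : (∫ x in (Ω : Set Plane), pd α φ x • u x) + ∫ x in (Ω : Set Plane), φ x • g x
      = (∫ x in (Ω : Set Plane), (pd α φ x - pd α ψ x) • u x)
        + ∫ x in (Ω : Set Plane), (φ x - ψ x) • g x := by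
    rw [e1, e2, e]; abel
  rw [e3]
  have b1 : ‖∫ x in (Ω : Set Plane), (pd α φ x - pd α ψ x) • u x‖
      ≤ ∫ x in (Ω : Set Plane), η / (K + 1) * ‖u x‖ := by
    refine norm_integral_le_of_norm_le (hui.norm.const_mul _) (Filter.Eventually.of_forall ?_)
    intro x
    rw [norm_smul, Real.norm_eq_abs, abs_sub_comm]
    exact mul_le_mul_of_nonneg_right (hψ x).2 (norm_nonneg _)
  have b2 : ‖∫ x in (Ω : Set Plane), (φ x - ψ x) • g x‖
      ≤ ∫ x in (Ω : Set Plane), η / (K + 1) * ‖g x‖ := by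
    refine norm_integral_le_of_norm_le (hgi.norm.const_mul _) (Filter.Eventually.of_forall ?_)
    intro x
    rw [norm_smul, Real.norm_eq_abs, abs_sub_comm]
    exact mul_le_mul_of_nonneg_right (hψ x).1 (norm_nonneg _)
  rw [integral_const_mul] at b1 b2
  refine (norm_add_le _ _).trans ((add_le_add b1 b2).trans ?_)
  rw [← mul_add, ← hK, zero_add, div_mul_eq_mul_div, div_le_iff₀ (by positivity)]
  nlinarith

lemma integral_coord {X : Type*} [MeasurableSpace X] {μ : Measure X} {f : X → Vec N}
    (hf : Integrable f μ) (i : Fin N) : (∫ x, f x ∂μ) i = ∫ x, f x i ∂μ :=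
  ((EuclideanSpace.proj (𝕜 := ℝ) i).integral_comp_comm hf).symm

lemma HasWeakDeriv.integral_coord_eq (hΩ : Bornology.IsBounded (Ω : Set Plane))
    (hu : HasWeakDeriv Ω α u g) {φ : Plane → ℝ} (hφ : ContDiff ℝ 1 φ)
    (hc : HasCompactSupport φ) (hs : tsupport φ ⊆ Ω) (i : Fin N) :
    ∫ x in (Ω : Set Plane), pd α φ x * u x i = -∫ x in (Ω : Set Plane), φ x * g x i := by
  have hφ2 := memLp_of_continuous_hasCompactSupport hφ.continuous hc Ω
  have hφ2' := memLp_of_continuous_hasCompactSupport (continuous_pd hφ one_ne_zero α)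
    (hasCompactSupport_pd hc α) Ω
  have := congrArg (fun z : Vec N => z i) (hu.integral_eq_of_contDiff_one hΩ hφ hc hs)
  simp only [PiLp.neg_apply] at this
  rw [integral_coord (integrable_smul_of_memLp_two hφ2' hu.memLp),
    integral_coord (integrable_smul_of_memLp_two hφ2 hu.memLp_deriv)] at this
  simpa using this

lemma hasWeakDeriv_of_coord (hu : MemLp u 2 (volume.restrict (Ω : Set Plane)))
    (hg : MemLp g 2 (volume.restrict (Ω : Set Plane)))
    (h : ∀ (φ : 𝓓(Ω, ℝ)) (i : Fin N),
      ∫ x in (Ω : Set Plane), pd α φ x * u x i = -∫ x in (Ω : Set Plane), φ x * g x i) :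
    HasWeakDeriv Ω α u g where
  memLp := hu
  memLp_deriv := hg
  integral_eq φ := by
    have hφ2 := memLp_of_continuous_hasCompactSupport φ.continuous φ.hasCompactSupport Ω
    have hφ2' := memLp_of_continuous_hasCompactSupport (continuous_pd φ.contDiff (by simp) α)
      (hasCompactSupport_pd φ.hasCompactSupport α) Ω
    ext i
    rw [PiLp.neg_apply, integral_coord (integrable_smul_of_memLp_two hφ2' hu),
      integral_coord (integrable_smul_of_memLp_two hφ2 hg)]
    simpa using h φ i

end WeakDerivatives

/-! ### Periodic functions and the unit cell -/

section Periodic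

lemma latticePoint_eq (h : Fin 2 → ℤ) :
    latticePoint h = h 0 • EuclideanSpace.single 0 (1 : ℝ)
      + h 1 • EuclideanSpace.single 1 (1 : ℝ) := by
  ext k
  fin_cases k <;> simp [latticePoint]

lemma IsPeriodic.of_single {f : Plane → ℝ}
    (hf : ∀ k : Fin 2, Function.Periodic f (EuclideanSpace.single k (1 : ℝ))) :
    IsPeriodic f := by
  intro y h
  rw [latticePoint_eq, ← add_assoc, (hf 1).zsmul, (hf 0).zsmul]

lemma IsPeriodic.single {F : Type*} {f : Plane → F} (hf : IsPeriodic f) (k : Fin 2) (y : Plane) :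
    f (y + EuclideanSpace.single k (1 : ℝ)) = f y := by
  have := hf y (Pi.single k 1)
  rw [← this]
  congr 2
  ext j
  by_cases hj : j = k <;> simp [latticePoint, hj, Pi.single_apply]

lemma IsPeriodic.exists_bound {f : Plane → ℝ} (hf : IsPeriodic f) (hc : Continuous f) :
    ∃ K : ℝ, ∀ y, |f y| ≤ K := by
  obtain ⟨K, hK⟩ := (isCompact_closedBall (0 : Plane) 2).exists_bound_of_continuousOn
    hc.continuousOn
  refine ⟨K, fun y => ?_⟩
  -- Translation to the fractional parts, which have norm at most `√2` and so lie in the ball of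
  -- radius `2`.
  have h := hf y fun k => -⌊y k⌋
  rw [← h]
  refine hK _ ?_
  rw [mem_closedBall_zero_iff, EuclideanSpace.norm_eq]
  refine Real.sqrt_le_iff.2 ⟨by norm_num, ?_⟩
  have hk : ∀ k, ‖(y + latticePoint fun k => -⌊y k⌋) k‖ ^ 2 ≤ 1 := by
    intro k
    have : (y + latticePoint fun k => -⌊y k⌋) k = Int.fract (y k) := by
      simp [latticePoint, Int.fract, sub_eq_add_neg]
    rw [this, Real.norm_eq_abs, sq_abs]
    exact pow_le_one₀ (Int.fract_nonneg _) (Int.fract_lt_one _).le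
  rw [Fin.sum_univ_two]
  linarith [hk 0, hk 1]

lemma IsPeriodic.pd {f : Plane → ℝ} (hf : IsPeriodic f) (α : Fin 2) : IsPeriodic (pd α f) := by
  intro y h
  have : f = fun z => f (z + latticePoint h) := by
    funext z
    rw [hf]
  simp only [Homogenization.pd]
  conv_rhs => rw [this]
  rw [fderiv_comp_add_right]

/-- The plane as a product of two lines. -/
def planeEquiv : ℝ × ℝ ≃ᵐ Plane :=
  MeasurableEquiv.finTwoArrow.symm.trans (MeasurableEquiv.toLp 2 (Fin 2 → ℝ))

lemma planeEquiv_apply (p : ℝ × ℝ) : planeEquiv p = !₂[p.1, p.2] := rfl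

lemma measurePreserving_planeEquiv : MeasurePreserving planeEquiv volume volume :=
  (EuclideanSpace.volume_preserving_symm_measurableEquiv_toLp (Fin 2)).symm.comp
    ((volume_preserving_finTwoArrow ℝ).symm _)

lemma planeEquiv_preimage_unitCell :
    planeEquiv ⁻¹' unitCell = Set.Ico (0 : ℝ) 1 ×ˢ Set.Ico (0 : ℝ) 1 := by
  ext p
  simp [unitCell, planeEquiv_apply, Fin.forall_fin_two]

lemma volume_unitCell : volume unitCell = 1 := by
  rw [← measurePreserving_planeEquiv.measure_preimage_equiv, planeEquiv_preimage_unitCell,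
    Measure.volume_eq_prod, Measure.prod_prod]
  simp

lemma integrableOn_unitCell {f : Plane → ℝ} (hf : Continuous f) : IntegrableOn f unitCell := by
  refine (hf.continuousOn.integrableOn_compact (isCompact_closedBall (0 : Plane) 2)).mono_set ?_
  intro y hy
  rw [mem_closedBall_zero_iff, EuclideanSpace.norm_eq]
  refine Real.sqrt_le_iff.2 ⟨by norm_num, ?_⟩
  have hk : ∀ k, ‖y k‖ ^ 2 ≤ 1 := by
    intro k
    rw [Real.norm_eq_abs, sq_abs]
    exact pow_le_one₀ (hy k).1 (hy k).2.le
  rw [Fin.sum_univ_two]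
  linarith [hk 0, hk 1]

lemma integrableOn_planeEquiv {f : Plane → ℝ} (hf : Continuous f) :
    IntegrableOn (fun p : ℝ × ℝ => f !₂[p.1, p.2]) (Set.Ico (0 : ℝ) 1 ×ˢ Set.Ico (0 : ℝ) 1) := by
  have := (measurePreserving_planeEquiv.integrableOn_comp_preimage
    planeEquiv.measurableEmbedding).2 (integrableOn_unitCell hf)
  rwa [planeEquiv_preimage_unitCell] at this

lemma setIntegral_unitCell {f : Plane → ℝ} (hf : Continuous f) :
    ∫ y in unitCell, f y = ∫ s in Set.Ico (0 : ℝ) 1, ∫ t in Set.Ico (0 : ℝ) 1, f !₂[s, t] := by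
  rw [← measurePreserving_planeEquiv.setIntegral_preimage_emb planeEquiv.measurableEmbedding,
    planeEquiv_preimage_unitCell, Measure.volume_eq_prod]
  exact setIntegral_prod _ (integrableOn_planeEquiv hf)

lemma setIntegral_unitCell_swap {f : Plane → ℝ} (hf : Continuous f) :
    ∫ y in unitCell, f y = ∫ t in Set.Ico (0 : ℝ) 1, ∫ s in Set.Ico (0 : ℝ) 1, f !₂[s, t] := by
  rw [setIntegral_unitCell hf]
  refine integral_integral_swap ?_
  rw [Measure.prod_restrict]
  exact integrableOn_planeEquiv hf

/-! ### Primitives of periodic fields and stream functions. -/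

lemma fderiv_apply_eq_pd {f : Plane → ℝ} (y v : Plane) :
    fderiv ℝ f y v = v 0 * pd 0 f y + v 1 * pd 1 f y := by
  have : v = v 0 • EuclideanSpace.single 0 (1 : ℝ) + v 1 • EuclideanSpace.single 1 (1 : ℝ) := by
    ext k
    fin_cases k <;> simp
  conv_lhs => rw [this]
  simp [pd]

lemma setIntegral_Ico_deriv {g g' : ℝ → ℝ} (hg : ∀ t, HasDerivAt g (g' t) t)
    (hc : Continuous g') : ∫ t in Set.Ico (0 : ℝ) 1, g' t = g 1 - g 0 := by
  rw [integral_Ico_eq_integral_Ioc, ← intervalIntegral.integral_of_le zero_le_one]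
  exact intervalIntegral.integral_eq_sub_of_hasDerivAt (fun t _ => hg t)
    (hc.intervalIntegrable _ _)

lemma hasDerivAt_comp_line {f : Plane → ℝ} (hf : Differentiable ℝ f) (a : Plane) (k : Fin 2)
    (t : ℝ) : HasDerivAt (fun t => f (a + t • EuclideanSpace.single k (1 : ℝ)))
      (pd k f (a + t • EuclideanSpace.single k (1 : ℝ))) t := by
  have h1 : HasDerivAt (fun t : ℝ => a + t • EuclideanSpace.single k (1 : ℝ))
      (EuclideanSpace.single k (1 : ℝ)) t := by
    simpa using ((hasDerivAt_id t).smul_const (EuclideanSpace.single k (1 : ℝ))).const_add a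
  exact (hf _).hasFDerivAt.comp_hasDerivAt t h1

/-- A function with periodic gradient of mean zero is periodic. -/
lemma isPeriodic_of_pd {f : Plane → ℝ} (hf : ContDiff ℝ 1 f)
    (hp : ∀ k, IsPeriodic (pd k f)) (h0 : ∀ k, ∫ y in unitCell, pd k f y = 0) :
    IsPeriodic f := by
  have hd := hf.differentiable one_ne_zero
  have hc := fun k => continuous_pd hf one_ne_zero k
  refine .of_single fun k => ?_
  -- The increment over one period has zero gradient because the gradient of `f` is periodic.
  obtain ⟨c, hcst⟩ : ∃ c, ∀ y, f (y + EuclideanSpace.single k (1 : ℝ)) - f y = c := by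
    refine ⟨f (0 + EuclideanSpace.single k (1 : ℝ)) - f 0, fun y => ?_⟩
    refine is_const_of_fderiv_eq_zero (𝕜 := ℝ)
      (f := fun y => f (y + EuclideanSpace.single k (1 : ℝ)) - f y) ?_ ?_ y 0
    · exact (hd.comp (differentiable_id.add_const _)).sub hd
    · intro y
      rw [fderiv_fun_sub (by fun_prop) (hd y), fderiv_comp_add_right]
      ext v
      simp only [sub_apply, fderiv_apply_eq_pd, (hp _).single]
      simp
  -- Every unit segment in direction `k` yields the same integral `c`; by Fubini `c` is then the
  -- mean of `pd k f` over the cell, which vanishes.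
  have hline : ∀ a : Plane, (∫ t in Set.Ico (0 : ℝ) 1,
      pd k f (a + t • EuclideanSpace.single k (1 : ℝ))) = c := by
    intro a
    rw [setIntegral_Ico_deriv (fun t => hasDerivAt_comp_line hd a k t)
      ((hc k).comp (by fun_prop))]
    simp only [one_smul, zero_smul, add_zero, hcst]
  have : c = 0 := by
    rw [← h0 k]
    fin_cases k
    · rw [Fin.zero_eta, setIntegral_unitCell_swap (hc 0)]
      have e : ∀ t : ℝ, (∫ s in Set.Ico (0 : ℝ) 1, pd 0 f !₂[s, t]) = c := by
        intro t
        rw [← hline !₂[0, t]]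
        congr 1; funext s; congr 1
        ext j
        fin_cases j <;> simp
      simp [e]
    · rw [Fin.mk_one, setIntegral_unitCell (hc 1)]
      have e : ∀ s : ℝ, (∫ t in Set.Ico (0 : ℝ) 1, pd 1 f !₂[s, t]) = c := by
        intro s
        rw [← hline !₂[s, 0]]
        congr 1; funext t; congr 1
        ext j
        fin_cases j <;> simp
      simp [e]
  intro y
  rw [← sub_eq_zero, hcst, this]

/-- A periodic solenoidal field of mean zero in the plane has a bounded stream function. -/
lemma exists_stream_function {b : Fin 2 → Plane → ℝ} (hb : ∀ α, ContDiff ℝ 1 (b α))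
    (hp : ∀ α, IsPeriodic (b α)) (hdiv : ∀ y, pd 0 (b 0) y + pd 1 (b 1) y = 0)
    (h0 : ∀ α, ∫ y in unitCell, b α y = 0) :
    ∃ ψ : Plane → ℝ, ContDiff ℝ 1 ψ ∧ IsPeriodic ψ ∧
      (∀ y, pd 1 ψ y = b 0 y) ∧ ∀ y, pd 0 ψ y = -b 1 y := by
  -- The 1-form `b 0 dy₁ - b 1 dy₀`. It is closed exactly when `b` is divergence free, so the
  -- Poincaré lemma on the plane provides a primitive.
  let η : Plane → Plane →L[ℝ] ℝ := fun y =>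
    b 0 y • EuclideanSpace.proj (𝕜 := ℝ) (1 : Fin 2) - b 1 y • EuclideanSpace.proj (𝕜 := ℝ) 0
  have hη : ContDiff ℝ 1 η :=
    ((hb 0).smul contDiff_const).sub ((hb 1).smul contDiff_const)
  have hη' : ∀ y v w, fderiv ℝ η y v w = fderiv ℝ (b 0) y v * w 1 - fderiv ℝ (b 1) y v * w 0 := by
    intro y v w
    have hd := fun α => ((hb α).differentiable one_ne_zero y).hasFDerivAt
    have := (((hd 0).smul_const (EuclideanSpace.proj (𝕜 := ℝ) (1 : Fin 2) : Plane →L[ℝ] ℝ)).sub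
      ((hd 1).smul_const (EuclideanSpace.proj (𝕜 := ℝ) (0 : Fin 2) : Plane →L[ℝ] ℝ))).fderiv
    change fderiv ℝ η y = _ at this
    rw [this]
    simp
  obtain ⟨ψ, hψ⟩ := convex_univ.exists_forall_hasFDerivAt_of_fderiv_symmetric isOpen_univ
    (hη.differentiable one_ne_zero).differentiableOn (by
      intro y _ v w
      simp only [hη', fderiv_apply_eq_pd]
      -- The exterior derivative of the form is the divergence times the area form.
      linear_combination (v 0 * w 1 - w 0 * v 1) * hdiv y)
  have hfd : fderiv ℝ ψ = η := funext fun y => (hψ y trivial).fderiv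
  have h1 : ∀ y, pd 1 ψ y = b 0 y := by
    intro y
    simp [pd, hfd, η]
  have h2 : ∀ y, pd 0 ψ y = -b 1 y := by
    intro y
    simp [pd, hfd, η]
  have hψ1 : ContDiff ℝ 1 ψ := by
    rw [contDiff_one_iff_fderiv]
    exact ⟨fun y => (hψ y trivial).differentiableAt, by rw [hfd]; exact hη.continuous⟩
  refine ⟨ψ, hψ1, isPeriodic_of_pd hψ1 ?_ ?_, h1, h2⟩
  · intro k
    fin_cases k
    · intro y h
      simp [h2, hp 1 y h]
    · intro y h
      simp [h1, hp 0 y h]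
  · intro k
    fin_cases k
    · simp [h2, integral_neg, h0]
    · simp [h1, h0]

end Periodic

/-! ### Square-integrable tensor fields -/

section Fields

variable {N : ℕ} {Ω : Opens Plane}

/-- The tensor fields `q = (q^1, q^2)` with square-integrable components. -/
def MemL2Field (Ω : Opens Plane) (q : Fin 2 → Plane → Vec N) : Prop :=
  ∀ α, MemLp (q α) 2 (volume.restrict (Ω : Set Plane))

/-- The `L²` norm of a tensor field. -/
def fieldNorm (Ω : Opens Plane) (q : Fin 2 → Plane → Vec N) : ℝ :=
  Real.sqrt (∑ α, ∫ x in (Ω : Set Plane), ‖q α x‖ ^ 2)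

/-- The `L²` pairing of tensor fields. -/
def pairing (Ω : Opens Plane) (p q : Fin 2 → Plane → Vec N) : ℝ :=
  ∫ x in (Ω : Set Plane), ∑ α, ∑ i, p α x i * q α x i

/-- The weak gradient as a tensor field. -/
def weakGrad (Ω : Opens Plane) (u : Plane → Vec N) : Fin 2 → Plane → Vec N :=
  fun α => weakDeriv Ω α u

/-- The flux `B^{αβ} p^β` of a tensor field. -/
def flux (B : Coeff N) (p : Fin 2 → Plane → Vec N) : Fin 2 → Plane → Vec N :=
  fun α x => WithLp.toLp 2 (∑ β, (B x α β).mulVec (p β x).ofLp)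

/-- Coefficient families with continuous entries bounded by `K`. -/
structure IsBoundedCoeff (B : Coeff N) (K : ℝ) : Prop where
  continuous : ∀ α β i j, Continuous fun x => B x α β i j
  bound : ∀ x α β i j, |B x α β i j| ≤ K

variable {p p' q q' : Fin 2 → Plane → Vec N} {B : Coeff N} {K : ℝ}

lemma MemH1.memL2Field {u : Plane → Vec N} (hu : MemH1 Ω u) : MemL2Field Ω (weakGrad Ω u) :=
  fun α => hu.memLp_weakDeriv α

lemma fieldNorm_nonneg (q : Fin 2 → Plane → Vec N) : 0 ≤ fieldNorm Ω q := Real.sqrt_nonneg _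

lemma integral_norm_sq_nonneg (f : Plane → Vec N) :
    0 ≤ ∫ x in (Ω : Set Plane), ‖f x‖ ^ 2 := integral_nonneg fun _ => by positivity

lemma fieldNorm_sq (q : Fin 2 → Plane → Vec N) :
    fieldNorm Ω q ^ 2 = ∑ α, ∫ x in (Ω : Set Plane), ‖q α x‖ ^ 2 :=
  Real.sq_sqrt (Finset.sum_nonneg fun α _ => integral_norm_sq_nonneg (q α))

lemma MemL2Field.sub (hp : MemL2Field Ω p) (hq : MemL2Field Ω q) : MemL2Field Ω (p - q) :=
  fun α => (hp α).sub (hq α)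

lemma MemL2Field.const_smul (hp : MemL2Field Ω p) (c : ℝ) : MemL2Field Ω (c • p) :=
  fun α => (hp α).const_smul c

lemma MemL2Field.sum {ι : Type*} {s : Finset ι} {P : ι → Fin 2 → Plane → Vec N}
    (hP : ∀ i ∈ s, MemL2Field Ω (P i)) : MemL2Field Ω (∑ i ∈ s, P i) := by
  intro α
  rw [Finset.sum_apply]
  exact memLp_finsetSum' _ fun i hi => hP i hi α

lemma MemLp.integrable_coord_mul {f h : Plane → Vec N} {μ : Measure Plane} (hf : MemLp f 2 μ)
    (hh : MemLp h 2 μ) (i j : Fin N) : Integrable (fun x => f x i * h x j) μ :=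
  (hf.eval_piLp i).integrable_mul (hh.eval_piLp j)

lemma MemL2Field.integrable_pairing (hp : MemL2Field Ω p) (hq : MemL2Field Ω q) :
    Integrable (fun x => ∑ α, ∑ i, p α x i * q α x i) (volume.restrict (Ω : Set Plane)) :=
  integrable_finsetSum _ fun α _ => integrable_finsetSum _ fun i _ =>
    MemLp.integrable_coord_mul (hp α) (hq α) i i

lemma pairing_congr (hp : ∀ α, p α =ᵐ[volume.restrict (Ω : Set Plane)] p' α)
    (hq : ∀ α, q α =ᵐ[volume.restrict (Ω : Set Plane)] q' α) :
    pairing Ω p q = pairing Ω p' q' := by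
  refine integral_congr_ae ?_
  filter_upwards [ae_all_iff.2 hp, ae_all_iff.2 hq] with x h1 h2
  simp only [h1, h2]

lemma pairing_comm (p q : Fin 2 → Plane → Vec N) : pairing Ω p q = pairing Ω q p := by
  simp only [pairing, mul_comm]

lemma pairing_sub_left (hp : MemL2Field Ω p) (hp' : MemL2Field Ω p') (hq : MemL2Field Ω q) :
    pairing Ω (p - p') q = pairing Ω p q - pairing Ω p' q := by
  rw [pairing, pairing, pairing, ← integral_sub (hp.integrable_pairing hq)
    (hp'.integrable_pairing hq)]
  simp [sub_mul]

lemma pairing_sub_right (hp : MemL2Field Ω p) (hq : MemL2Field Ω q) (hq' : MemL2Field Ω q') :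
    pairing Ω p (q - q') = pairing Ω p q - pairing Ω p q' := by
  rw [pairing_comm, pairing_sub_left hq hq' hp, pairing_comm, pairing_comm q']

lemma pairing_smul_left (c : ℝ) (p q : Fin 2 → Plane → Vec N) :
    pairing Ω (c • p) q = c * pairing Ω p q := by
  rw [pairing, pairing, ← integral_const_mul]
  simp [mul_add, Finset.mul_sum, mul_assoc]

lemma pairing_sum_left {ι : Type*} {s : Finset ι} {P : ι → Fin 2 → Plane → Vec N}
    (hP : ∀ i ∈ s, MemL2Field Ω (P i)) (hq : MemL2Field Ω q) :
    pairing Ω (∑ i ∈ s, P i) q = ∑ i ∈ s, pairing Ω (P i) q := by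
  classical
  induction s using Finset.induction_on with
  | empty => simp [pairing]
  | insert a s ha ih =>
    have h1 : MemL2Field Ω (P a) := hP a (Finset.mem_insert_self a s)
    have h2 : ∀ i ∈ s, MemL2Field Ω (P i) := fun i hi => hP i (Finset.mem_insert_of_mem hi)
    rw [Finset.sum_insert ha, Finset.sum_insert ha, ← ih h2, pairing, pairing, pairing,
      ← integral_add (h1.integrable_pairing hq) ((MemL2Field.sum h2).integrable_pairing hq)]
    simp [add_mul, Finset.sum_add_distrib]

lemma integral_norm_mul_norm_le {E : Type*} [NormedAddCommGroup E] {f h : Plane → E} {μ : Measure Plane} (hf : MemLp f 2 μ)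
    (hh : MemLp h 2 μ) :
    ∫ x, ‖f x‖ * ‖h x‖ ∂μ ≤ Real.sqrt (∫ x, ‖f x‖ ^ 2 ∂μ) * Real.sqrt (∫ x, ‖h x‖ ^ 2 ∂μ) := by
  have := integral_mul_norm_le_Lp_mul_Lq (μ := μ) (f := f) (g := h) Real.HolderConjugate.two_two
    (by simpa using hf) (by simpa using hh)
  simpa [Real.sqrt_eq_rpow] using this

lemma abs_pairing_le (hp : MemL2Field Ω p) (hq : MemL2Field Ω q) :
    |pairing Ω p q| ≤ fieldNorm Ω p * fieldNorm Ω q := by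
  have hi : ∀ α, Integrable (fun x => ‖p α x‖ * ‖q α x‖) (volume.restrict (Ω : Set Plane)) :=
    fun α => (hp α).norm.integrable_mul (hq α).norm
  calc |pairing Ω p q| ≤ ∫ x in (Ω : Set Plane), ∑ α, ‖p α x‖ * ‖q α x‖ := by
        rw [← Real.norm_eq_abs]
        refine norm_integral_le_of_norm_le (integrable_finsetSum _ fun α _ => hi α)
          (Filter.Eventually.of_forall fun x => ?_)
        refine (norm_sum_le _ _).trans (Finset.sum_le_sum fun α _ => ?_)
        have := abs_real_inner_le_norm (q α x) (p α x)
        simpa [PiLp.inner_apply, mul_comm] using this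
    _ = ∑ α, ∫ x in (Ω : Set Plane), ‖p α x‖ * ‖q α x‖ := integral_finsetSum _ fun α _ => hi α
    _ ≤ ∑ α, Real.sqrt (∫ x in (Ω : Set Plane), ‖p α x‖ ^ 2)
          * Real.sqrt (∫ x in (Ω : Set Plane), ‖q α x‖ ^ 2) :=
        Finset.sum_le_sum fun α _ => integral_norm_mul_norm_le (hp α) (hq α)
    _ ≤ fieldNorm Ω p * fieldNorm Ω q := by
        refine (Real.sum_mul_le_sqrt_mul_sqrt _ _ _).trans_eq ?_
        simp only [fieldNorm, Real.sq_sqrt (integral_norm_sq_nonneg _)]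

/-! ### Fluxes with bounded coefficients and the energy form. -/

lemma memLp_continuous_mul {f : Plane → ℝ} {m : Plane → ℝ} {μ : Measure Plane}
    (hf : MemLp f 2 μ) (hm : Continuous m) (hK : ∀ x, |m x| ≤ K) :
    MemLp (fun x => m x * f x) 2 μ := by
  refine hf.of_le_mul (c := K) (hm.aestronglyMeasurable.mul hf.1) (Filter.Eventually.of_forall ?_)
  intro x
  rw [norm_mul]
  exact mul_le_mul_of_nonneg_right (hK x) (norm_nonneg _)

lemma flux_apply (B : Coeff N) (p : Fin 2 → Plane → Vec N) (α : Fin 2) (x : Plane) (i : Fin N) :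
    flux B p α x i = ∑ β, ∑ j, B x α β i j * p β x j := by
  simp [flux, Matrix.mulVec, dotProduct]

lemma IsBoundedCoeff.memL2Field_flux (hB : IsBoundedCoeff B K) (hp : MemL2Field Ω p) :
    MemL2Field Ω (flux B p) := by
  refine fun α => MemLp.of_eval_piLp fun i => ?_
  simp only [flux_apply]
  exact memLp_finsetSum _ fun β _ => memLp_finsetSum _ fun j _ =>
    memLp_continuous_mul ((hp β).eval_piLp j) (hB.continuous α β i j) fun x => hB.bound x α β i j

lemma energyForm_eq_pairing (B : Coeff N) (u v : Plane → Vec N) :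
    energyForm Ω B u v = pairing Ω (flux B (weakGrad Ω u)) (weakGrad Ω v) := by
  refine integral_congr_ae (Filter.Eventually.of_forall fun x => ?_)
  refine Finset.sum_congr rfl fun α _ => ?_
  rw [Finset.sum_comm]
  refine Finset.sum_congr rfl fun i _ => ?_
  simp only [flux_apply, Finset.sum_mul, weakGrad]

lemma flux_sub (B : Coeff N) (p q : Fin 2 → Plane → Vec N) :
    flux B (p - q) = flux B p - flux B q := by
  funext α x
  ext i
  simp [flux_apply, mul_sub]

lemma flux_smul (B : Coeff N) (c : ℝ) (p : Fin 2 → Plane → Vec N) :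
    flux B (c • p) = c • flux B p := by
  funext α x
  ext i
  simp [flux_apply, mul_add, Finset.mul_sum, mul_left_comm]

lemma flux_congr (B : Coeff N) (hp : ∀ α, p α =ᵐ[volume.restrict (Ω : Set Plane)] p' α)
    (α : Fin 2) : flux B p α =ᵐ[volume.restrict (Ω : Set Plane)] flux B p' α := by
  filter_upwards [ae_all_iff.2 hp] with x hx
  simp only [flux, hx]

lemma energyForm_sub_left (hB : IsBoundedCoeff B K) {u v w : Plane → Vec N} (hu : MemH1 Ω u)
    (hv : MemH1 Ω v) (hw : MemH1 Ω w) :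
    energyForm Ω B (fun x => u x - v x) w = energyForm Ω B u w - energyForm Ω B v w := by
  simp only [energyForm_eq_pairing]
  rw [← pairing_sub_left (hB.memL2Field_flux hu.memL2Field) (hB.memL2Field_flux hv.memL2Field)
    hw.memL2Field, ← flux_sub]
  exact pairing_congr (flux_congr B fun α => hu.weakDeriv_sub hv α) fun α => Filter.EventuallyEq.rfl

lemma energyForm_smul_left (B : Coeff N) (c : ℝ) {u : Plane → Vec N} (hu : MemH1 Ω u)
    (w : Plane → Vec N) :
    energyForm Ω B (fun x => c • u x) w = c * energyForm Ω B u w := by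
  simp only [energyForm_eq_pairing]
  rw [← pairing_smul_left, ← flux_smul]
  exact pairing_congr (flux_congr B fun α => hu.weakDeriv_const_smul c α)
    fun α => Filter.EventuallyEq.rfl

/-- Each component is at most `N K ∑ ‖p β‖`. Squaring and summing over `N` components gives `N³K²`,
and the `2` comes from `(a + b)² ≤ 2(a² + b²)`. -/
lemma norm_flux_sq_le (hB : IsBoundedCoeff B K) (hK : 0 ≤ K) (p : Fin 2 → Plane → Vec N)
    (α : Fin 2) (x : Plane) :
    ‖flux B p α x‖ ^ 2 ≤ 2 * N ^ 3 * K ^ 2 * ∑ β, ‖p β x‖ ^ 2 := by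
  have hi : ∀ i, |flux B p α x i| ≤ N * K * ∑ β, ‖p β x‖ := by
    intro i
    rw [flux_apply, Finset.mul_sum]
    refine (Finset.abs_sum_le_sum_abs _ _).trans (Finset.sum_le_sum fun β _ => ?_)
    refine (Finset.abs_sum_le_sum_abs _ _).trans ?_
    have : ∀ j ∈ Finset.univ, |B x α β i j * p β x j| ≤ K * ‖p β x‖ := by
      intro j _
      rw [abs_mul]
      exact mul_le_mul (hB.bound _ _ _ _ _) (PiLp.norm_apply_le (p β x) j) (abs_nonneg _) hK
    refine (Finset.sum_le_card_nsmul _ _ _ this).trans_eq ?_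
    simp [mul_assoc]
  rw [EuclideanSpace.norm_sq_eq]
  calc ∑ i, ‖flux B p α x i‖ ^ 2 ≤ ∑ _i : Fin N, (N * K * ∑ β, ‖p β x‖) ^ 2 :=
        Finset.sum_le_sum fun i _ => pow_le_pow_left₀ (norm_nonneg _) (hi i) 2
    _ = N ^ 3 * K ^ 2 * (∑ β, ‖p β x‖) ^ 2 := by
        simp only [Finset.sum_const, Finset.card_univ, Fintype.card_fin, nsmul_eq_mul]; ring
    _ ≤ N ^ 3 * K ^ 2 * (2 * ∑ β, ‖p β x‖ ^ 2) := by
        refine mul_le_mul_of_nonneg_left ?_ (by positivity)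
        rw [Fin.sum_univ_two, Fin.sum_univ_two]
        nlinarith [sq_nonneg (‖p 0 x‖ - ‖p 1 x‖)]
    _ = _ := by ring

lemma integrable_norm_sq {f : Plane → Vec N} {μ : Measure Plane} (hf : MemLp f 2 μ) :
    Integrable (fun x => ‖f x‖ ^ 2) μ :=
  hf.integrable_norm_pow (by norm_num)

lemma fieldNorm_flux_le (hB : IsBoundedCoeff B K) (hK : 0 ≤ K) (hp : MemL2Field Ω p) :
    fieldNorm Ω (flux B p) ≤ 2 * N ^ 2 * K * fieldNorm Ω p := by
  have h1 : ∀ α, ∫ x in (Ω : Set Plane), ‖flux B p α x‖ ^ 2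
      ≤ 2 * N ^ 3 * K ^ 2 * fieldNorm Ω p ^ 2 := by
    intro α
    rw [fieldNorm_sq, ← integral_finsetSum _ fun β _ => integrable_norm_sq (hp β),
      ← integral_const_mul]
    exact integral_mono (integrable_norm_sq (hB.memL2Field_flux hp α))
      ((integrable_finsetSum _ fun β _ => integrable_norm_sq (hp β)).const_mul _)
      fun x => norm_flux_sq_le hB hK p α x
  have h0 := fieldNorm_nonneg (Ω := Ω) p
  refine abs_le_of_sq_le_sq' ?_ (by positivity) |>.2
  rw [fieldNorm_sq]
  refine (Finset.sum_le_card_nsmul _ _ _ fun α _ => h1 α).trans ?_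
  -- The two values of `α` give `4N³K²`; weakening `N³` to `N⁴` makes this a perfect square.
  have hN : (N : ℝ) ^ 3 ≤ N ^ 4 := by
    rcases Nat.eq_zero_or_pos N with rfl | hN
    · simp
    · exact pow_le_pow_right₀ (by exact_mod_cast hN) (by norm_num)
  simp only [Finset.card_univ, Fintype.card_fin, nsmul_eq_mul]
  calc ((2 : ℕ) : ℝ) * (2 * N ^ 3 * K ^ 2 * fieldNorm Ω p ^ 2)
      = N ^ 3 * (4 * K ^ 2 * fieldNorm Ω p ^ 2) := by push_cast; ring
    _ ≤ N ^ 4 * (4 * K ^ 2 * fieldNorm Ω p ^ 2) := mul_le_mul_of_nonneg_right hN (by positivity)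
    _ = _ := by ring

end Fields

lemma integrable_mul_of_memLp_two {X : Type*} [MeasurableSpace X] {μ : Measure X} {f h : X → ℝ}
    (hf : MemLp f 2 μ) (hh : MemLp h 2 μ) : Integrable (fun x => f x * h x) μ :=
  hf.integrable_mul hh

/-! ### The correctors -/

section Correctors

variable {N : ℕ} {Ω : Opens Plane} {A : Coeff N}
  {χ : Fin 2 → Plane → Matrix (Fin N) (Fin N) ℝ}

/-- The entrywise partial derivative `∂_β χ^γ`. -/
def pdMatrix (β : Fin 2) (M : Plane → Matrix (Fin N) (Fin N) ℝ) (y : Plane) :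
    Matrix (Fin N) (Fin N) ℝ := Matrix.of fun i j => pd β (fun z => M z i j) y

/-- The flux corrector `b^{αγ} = A^{αγ} + A^{αβ} ∂_β χ^γ - A^{0,αγ}`. -/
def fluxCorrector (A : Coeff N) (χ : Fin 2 → Plane → Matrix (Fin N) (Fin N) ℝ) : Coeff N :=
  fun y α γ => A y α γ + ∑ β, A y α β * pdMatrix β (χ γ) y - homogenized A χ y α γ

lemma fluxCorrector_apply (y : Plane) (α γ : Fin 2) (i j : Fin N) :
    fluxCorrector A χ y α γ i j
      = (∑ β, ∑ k, A y α β i k * pd β (fun t => χ γ t k j) y) + A y α γ i j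
        - homogenized A χ 0 α γ i j := by
  simp only [fluxCorrector, Matrix.sub_apply, Matrix.add_apply, Matrix.sum_apply,
    Matrix.mul_apply, pdMatrix, Matrix.of_apply]
  rw [add_comm (A y α γ i j)]
  rfl

lemma IsCellCorrector.contDiff_pd (hχ : IsCellCorrector A χ) (β γ : Fin 2) (k j : Fin N) :
    ContDiff ℝ 1 (pd β fun t => χ γ t k j) :=
  Homogenization.contDiff_pd (hχ.contDiff γ k j) (by norm_num) β

lemma IsCellCorrector.contDiff_sum (hA : IsSmoothCoeff A) (hχ : IsCellCorrector A χ)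
    (α γ : Fin 2) (i j : Fin N) :
    ContDiff ℝ 1 fun y => ∑ β, ∑ k, A y α β i k * pd β (fun t => χ γ t k j) y :=
  ContDiff.sum fun β _ => ContDiff.sum fun k _ =>
    ((hA α β i k).of_le (by simp)).mul (hχ.contDiff_pd β γ k j)

lemma contDiff_fluxCorrector (hA : IsSmoothCoeff A) (hχ : IsCellCorrector A χ)
    (α γ : Fin 2) (i j : Fin N) : ContDiff ℝ 1 fun y => fluxCorrector A χ y α γ i j := by
  simp only [fluxCorrector_apply]
  exact ((hχ.contDiff_sum hA α γ i j).add ((hA α γ i j).of_le (by simp))).sub contDiff_const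

lemma isPeriodic_fluxCorrector (hA : IsPeriodic A) (hχ : IsCellCorrector A χ)
    (α γ : Fin 2) (i j : Fin N) : IsPeriodic fun y => fluxCorrector A χ y α γ i j := by
  intro y h
  have : ∀ β k, pd β (fun t => χ γ t k j) (y + latticePoint h) = pd β (fun t => χ γ t k j) y :=
    fun β k => IsPeriodic.pd (f := fun t => χ γ t k j)
      (fun z l => by simp only [hχ.periodic γ z l]) β y h
  simp only [fluxCorrector_apply, hA y h, this]

/-- This is the cell problem itself: the constant tensor `A⁰` disappears under differentiation. -/
lemma fluxCorrector_div (hA : IsSmoothCoeff A) (hχ : IsCellCorrector A χ)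
    (γ : Fin 2) (i j : Fin N) (y : Plane) :
    pd 0 (fun y => fluxCorrector A χ y 0 γ i j) y
      + pd 1 (fun y => fluxCorrector A χ y 1 γ i j) y = 0 := by
  have h1 : ∀ α, pd α (fun y => fluxCorrector A χ y α γ i j) y
      = pd α (fun z => ∑ β, ∑ k, A z α β i k * pd β (fun t => χ γ t k j) z) y
        + pd α (fun z => A z α γ i j) y := by
    intro α
    have d1 := ((hχ.contDiff_sum hA α γ i j).differentiable one_ne_zero) y
    have d2 := ((hA α γ i j).differentiable (by simp)) y
    simp only [fluxCorrector_apply]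
    rw [pd, fderiv_sub_const, fderiv_fun_add d1 d2]
    rfl
  have := hχ.equation γ i j y
  rw [Fin.sum_univ_two, Fin.sum_univ_two] at this
  rw [h1, h1]
  linarith

/-- `A⁰` is by definition the mean of the other two terms over a cell of volume one. -/
lemma integral_fluxCorrector (hA : IsSmoothCoeff A) (hχ : IsCellCorrector A χ)
    (α γ : Fin 2) (i j : Fin N) : ∫ y in unitCell, fluxCorrector A χ y α γ i j = 0 := by
  have h1 := integrableOn_unitCell (hχ.contDiff_sum hA α γ i j).continuous
  have h2 := integrableOn_unitCell (hA α γ i j).continuous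
  have h3 : IntegrableOn (fun _ : Plane => homogenized A χ 0 α γ i j) unitCell :=
    integrableOn_unitCell continuous_const
  have h12 : IntegrableOn (fun y => (∑ β, ∑ k, A y α β i k * pd β (fun t => χ γ t k j) y)
      + A y α γ i j) unitCell := h1.add h2
  simp only [fluxCorrector_apply]
  rw [integral_sub h12 h3, integral_add h1 h2, setIntegral_const, measureReal_def,
    volume_unitCell, homogenized]
  simp
  ring

/-- Stream functions of the columns of the flux corrector. -/
lemma exists_flux_potential (hAp : IsPeriodic A) (hA : IsSmoothCoeff A)
    (hχ : IsCellCorrector A χ) :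
    ∃ Ψ : Fin 2 → Plane → Matrix (Fin N) (Fin N) ℝ,
      (∀ γ i j, ContDiff ℝ 1 fun y => Ψ γ y i j) ∧
      (∀ γ i j, IsPeriodic fun y => Ψ γ y i j) ∧
      (∀ γ i j y, pd 1 (fun y => Ψ γ y i j) y = fluxCorrector A χ y 0 γ i j) ∧
      ∀ γ i j y, pd 0 (fun y => Ψ γ y i j) y = -fluxCorrector A χ y 1 γ i j := by
  have := fun γ i j => exists_stream_function
    (b := fun α y => fluxCorrector A χ y α γ i j)
    (fun α => contDiff_fluxCorrector hA hχ α γ i j)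
    (fun α => isPeriodic_fluxCorrector hAp hχ α γ i j)
    (fluxCorrector_div hA hχ γ i j)
    (fun α => integral_fluxCorrector hA hχ α γ i j)
  choose ψ h1 h2 h3 h4 using this
  exact ⟨fun γ y => Matrix.of fun i j => ψ γ i j y, h1, h2, h3, h4⟩

/-- Finitely many continuous periodic functions have a common bound. -/
lemma exists_uniform_bound {ι : Type*} [Finite ι] {f : ι → Plane → ℝ}
    (hp : ∀ i, IsPeriodic (f i)) (hc : ∀ i, Continuous (f i)) :
    ∃ K : ℝ, 0 ≤ K ∧ ∀ i y, |f i y| ≤ K := by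
  have := Fintype.ofFinite ι
  choose k hk using fun i => (hp i).exists_bound (hc i)
  refine ⟨∑ i, |k i|, Finset.sum_nonneg fun i _ => abs_nonneg _, fun i y => ?_⟩
  exact (hk i y).trans ((le_abs_self _).trans
    (Finset.single_le_sum (f := fun i => |k i|) (fun i _ => abs_nonneg _) (Finset.mem_univ i)))

lemma exists_isBoundedCoeff {B : Coeff N} (hp : IsPeriodic B)
    (hc : ∀ α β i j, Continuous fun y => B y α β i j) :
    ∃ K, 0 ≤ K ∧ ∀ ε, IsBoundedCoeff (oscillating B ε) K := by
  obtain ⟨K, hK, h⟩ := exists_uniform_bound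
    (f := fun (m : Fin 2 × Fin 2 × Fin N × Fin N) y => B y m.1 m.2.1 m.2.2.1 m.2.2.2)
    (fun m y l => by simp only [hp y l]) (fun m => hc _ _ _ _)
  exact ⟨K, hK, fun ε => ⟨fun α β i j => (hc α β i j).comp (continuous_const_smul _),
    fun x α β i j => h (α, β, i, j) _⟩⟩

/-! ### Product rules -/

/-- The weak derivative of `u` is tested against `φ m`, which is only of class `C¹`, and the
classical Leibniz rule is used on that product. -/
lemma HasWeakDeriv.integral_mul_coord (hΩ : Bornology.IsBounded (Ω : Set Plane)) {β : Fin 2}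
    {u g : Plane → Vec N} (hu : HasWeakDeriv Ω β u g) {m : Plane → ℝ} (hm : ContDiff ℝ 1 m)
    (φ : 𝓓(Ω, ℝ)) (k : Fin N) :
    ∫ x in (Ω : Set Plane), pd β φ x * (m x * u x k)
      = -∫ x in (Ω : Set Plane), φ x * (pd β m x * u x k + m x * g x k) := by
  have hφ1 : ContDiff ℝ 1 φ := φ.contDiff.of_le (by simp)
  have hc : HasCompactSupport fun x => φ x * m x := φ.hasCompactSupport.mul_right
  have hs : tsupport (fun x => φ x * m x) ⊆ Ω :=
    (tsupport_mul_subset_left (f := φ) (g := m)).trans φ.tsupport_subset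
  have key := hu.integral_coord_eq hΩ (hφ1.mul hm) hc hs k
  have hcm := continuous_pd hm one_ne_zero β
  have m1 : MemLp (fun x => pd β φ x * m x) 2 (volume.restrict (Ω : Set Plane)) := memLp_of_continuous_hasCompactSupport
    ((continuous_pd hφ1 one_ne_zero β).mul hm.continuous)
    (hasCompactSupport_pd φ.hasCompactSupport β).mul_right Ω
  have m2 : MemLp (fun x => φ x * pd β m x) 2 (volume.restrict (Ω : Set Plane)) := memLp_of_continuous_hasCompactSupport (φ.continuous.mul hcm)
    φ.hasCompactSupport.mul_right Ω
  have m3 := memLp_of_continuous_hasCompactSupport (hφ1.mul hm).continuous hc Ω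
  have i1 := integrable_mul_of_memLp_two m1 (hu.memLp.eval_piLp k)
  have i2 := integrable_mul_of_memLp_two m2 (hu.memLp.eval_piLp k)
  have i3 := integrable_mul_of_memLp_two m3 (hu.memLp_deriv.eval_piLp k)
  have e1 : ∫ x in (Ω : Set Plane), pd β (fun x => φ x * m x) x * u x k
      = (∫ x in (Ω : Set Plane), pd β φ x * m x * u x k)
        + ∫ x in (Ω : Set Plane), φ x * pd β m x * u x k := by
    rw [← integral_add i1 i2]
    congr 1
    funext x
    rw [pd_mul (hφ1.differentiable one_ne_zero x) (hm.differentiable one_ne_zero x)]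
    ring
  have e2 : ∫ x in (Ω : Set Plane), φ x * (pd β m x * u x k + m x * g x k)
      = (∫ x in (Ω : Set Plane), φ x * pd β m x * u x k)
        + ∫ x in (Ω : Set Plane), φ x * m x * g x k := by
    rw [← integral_add i2 i3]
    congr 1
    funext x
    ring
  rw [e2]
  rw [e1] at key
  simp only [← mul_assoc]
  linarith

/-- The product rule for a bounded matrix field of class `C¹` and a function in `H¹`. -/
lemma HasWeakDeriv.mulVec (hΩ : Bornology.IsBounded (Ω : Set Plane)) {β : Fin 2}
    {u g : Plane → Vec N} (hu : HasWeakDeriv Ω β u g) {M : Plane → Matrix (Fin N) (Fin N) ℝ}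
    (hM : ∀ i j, ContDiff ℝ 1 fun y => M y i j) {K K' : ℝ} (hK : ∀ i j x, |M x i j| ≤ K)
    (hK' : ∀ i j x, |pdMatrix β M x i j| ≤ K') :
    HasWeakDeriv Ω β (fun x => WithLp.toLp 2 ((M x).mulVec (u x).ofLp))
      (fun x => WithLp.toLp 2
        ((pdMatrix β M x).mulVec (u x).ofLp + (M x).mulVec (g x).ofLp)) := by
  have hu1 : ∀ i j, MemLp (fun x => M x i j * u x j) 2 (volume.restrict (Ω : Set Plane)) :=
    fun i j => memLp_continuous_mul (hu.memLp.eval_piLp j) (hM i j).continuous (hK i j)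
  have hu2 : ∀ i j, MemLp (fun x => pdMatrix β M x i j * u x j + M x i j * g x j) 2
      (volume.restrict (Ω : Set Plane)) := fun i j =>
    (memLp_continuous_mul (hu.memLp.eval_piLp j) (continuous_pd (hM i j) one_ne_zero β)
      (hK' i j)).add
    (memLp_continuous_mul (hu.memLp_deriv.eval_piLp j) (hM i j).continuous (hK i j))
  have c1 : ∀ x i, (M x).mulVec (u x).ofLp i = ∑ j, M x i j * u x j := fun _ _ => rfl
  have c2 : ∀ x i, ((pdMatrix β M x).mulVec (u x).ofLp + (M x).mulVec (g x).ofLp) i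
      = ∑ j, (pdMatrix β M x i j * u x j + M x i j * g x j) := by
    intro x i
    rw [Finset.sum_add_distrib]
    rfl
  refine hasWeakDeriv_of_coord (MemLp.of_eval_piLp fun i => ?_) (MemLp.of_eval_piLp fun i => ?_)
    fun φ i => ?_
  · simp only [c1]
    exact memLp_finsetSum _ fun j _ => hu1 i j
  · simp only [c2]
    exact memLp_finsetSum _ fun j _ => hu2 i j
  · have hφ2 := memLp_of_continuous_hasCompactSupport φ.continuous φ.hasCompactSupport Ω
    have hφ2' := memLp_of_continuous_hasCompactSupport (continuous_pd φ.contDiff (by simp) β)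
      (hasCompactSupport_pd φ.hasCompactSupport β) Ω
    simp only [c1, c2, Finset.mul_sum]
    rw [integral_finsetSum _ fun j _ => integrable_mul_of_memLp_two hφ2' (hu1 i j),
      integral_finsetSum _ fun j _ => integrable_mul_of_memLp_two hφ2 (hu2 i j), ← Finset.sum_neg_distrib]
    exact Finset.sum_congr rfl fun j _ => hu.integral_mul_coord hΩ (hM i j) φ j

/-- Integration by parts against the rotated gradient of a stream function. -/
lemma integral_stream_function (hΩ : Bornology.IsBounded (Ω : Set Plane))
    {u g₀ g₁ : Plane → Vec N} (h0 : HasWeakDeriv Ω 0 u g₀) (h1 : HasWeakDeriv Ω 1 u g₁)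
    {ψ : Plane → ℝ} (hψ : ContDiff ℝ 1 ψ) {η : Plane → ℝ} (hη : ContDiff ℝ ∞ η)
    (hc : HasCompactSupport η) (hs : tsupport η ⊆ Ω) (k : Fin N) :
    ∫ x in (Ω : Set Plane), (pd 1 ψ x * pd 0 η x - pd 0 ψ x * pd 1 η x) * u x k
      = -∫ x in (Ω : Set Plane), ψ x * (pd 0 η x * g₁ x k - pd 1 η x * g₀ x k) := by
  have h2 : (2 : WithTop ℕ∞) ≤ ∞ := WithTop.coe_le_coe.2 (le_top : (2 : ℕ∞) ≤ ⊤)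
  have h11 : (1 + 1 : WithTop ℕ∞) ≤ ∞ := one_add_one_eq_two.trans_le h2
  have hη' : ∀ α, ContDiff ℝ 1 (pd α η) := fun α => contDiff_pd hη h11 α
  have hc' : ∀ α, HasCompactSupport fun x => ψ x * pd α η x := fun α =>
    (hasCompactSupport_pd hc α).mul_left
  have hs' : ∀ α, tsupport (fun x => ψ x * pd α η x) ⊆ Ω := fun α =>
    (tsupport_mul_subset_right (f := ψ) (g := pd α η)).trans ((tsupport_pd_subset η α).trans hs)
  have hd : ∀ α, ContDiff ℝ 1 fun x => ψ x * pd α η x := fun α => hψ.mul (hη' α)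
  -- The test functions are `ψ ∂₀η` for the derivative `∂₁u` and `ψ ∂₁η` for `∂₀u`. In the
  -- difference the terms `ψ ∂₁∂₀η` and `ψ ∂₀∂₁η` cancel by symmetry, so `ψ` need only be `C¹`.
  have k0 := h1.integral_coord_eq hΩ (hd 0) (hc' 0) (hs' 0) k
  have k1 := h0.integral_coord_eq hΩ (hd 1) (hc' 1) (hs' 1) k
  have m := fun α => memLp_of_continuous_hasCompactSupport (hd α).continuous (hc' α) Ω
  have m' := fun α β => memLp_of_continuous_hasCompactSupport
    (continuous_pd (hd α) one_ne_zero β) (hasCompactSupport_pd (hc' α) β) Ω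
  have hsymm : ∀ x, pd 1 (pd 0 η) x = pd 0 (pd 1 η) x := by
    intro x
    have hd2 : DifferentiableAt ℝ (fderiv ℝ η) x :=
      (hη.fderiv_right (m := 1) h11).differentiable one_ne_zero x
    have := (hη.contDiffAt (x := x)).isSymmSndFDerivAt (by simpa using h2)
    have hfun : ∀ α, pd α η = fun y => fderiv ℝ η y (EuclideanSpace.single α 1) := fun _ => rfl
    rw [pd, pd, hfun, hfun, fderiv_clm_apply hd2 (differentiableAt_const _),
      fderiv_clm_apply hd2 (differentiableAt_const _)]
    simpa using this.eq (EuclideanSpace.single 1 1) (EuclideanSpace.single 0 1)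
  have e1 : ∫ x in (Ω : Set Plane), (pd 1 ψ x * pd 0 η x - pd 0 ψ x * pd 1 η x) * u x k
      = (∫ x in (Ω : Set Plane), pd 1 (fun x => ψ x * pd 0 η x) x * u x k)
        - ∫ x in (Ω : Set Plane), pd 0 (fun x => ψ x * pd 1 η x) x * u x k := by
    rw [← integral_sub (integrable_mul_of_memLp_two (m' 0 1) (h0.memLp.eval_piLp k))
      (integrable_mul_of_memLp_two (m' 1 0) (h0.memLp.eval_piLp k))]
    congr 1
    funext x
    rw [pd_mul (hψ.differentiable one_ne_zero x) ((hη' 0).differentiable one_ne_zero x),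
      pd_mul (hψ.differentiable one_ne_zero x) ((hη' 1).differentiable one_ne_zero x), hsymm]
    ring
  have e2 : ∫ x in (Ω : Set Plane), ψ x * (pd 0 η x * g₁ x k - pd 1 η x * g₀ x k)
      = (∫ x in (Ω : Set Plane), ψ x * pd 0 η x * g₁ x k)
        - ∫ x in (Ω : Set Plane), ψ x * pd 1 η x * g₀ x k := by
    rw [← integral_sub (integrable_mul_of_memLp_two (m 0) (h1.memLp_deriv.eval_piLp k))
      (integrable_mul_of_memLp_two (m 1) (h0.memLp_deriv.eval_piLp k))]
    congr 1
    funext x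
    ring
  rw [e1, e2, k0, k1]
  ring

end Correctors

/-! ### The equation of the remainder -/

section Remainder

variable {N : ℕ} {Ω : Opens Plane} {A : Coeff N}
  {χ Ψ : Fin 2 → Plane → Matrix (Fin N) (Fin N) ℝ} {u₀ : Plane → Vec N} {ε : ℝ}

lemma HasWeakDeriv.add {β : Fin 2} {u v g h : Plane → Vec N} (hu : HasWeakDeriv Ω β u g)
    (hv : HasWeakDeriv Ω β v h) :
    HasWeakDeriv Ω β (fun x => u x + v x) (fun x => g x + h x) := by
  simpa using hu.sub (hv.const_smul (-1))

/-- The weak derivative of the first corrector. -/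
def firstCorrectorDeriv (Ω : Opens Plane) (χ : Fin 2 → Plane → Matrix (Fin N) (Fin N) ℝ)
    (ε : ℝ) (u₀ : Plane → Vec N) : Fin 2 → Plane → Vec N := fun β x =>
  ∑ γ, WithLp.toLp 2 ((ε⁻¹ • pdMatrix β (χ γ) (ε⁻¹ • x)).mulVec (weakDeriv Ω γ u₀ x).ofLp
    + (χ γ (ε⁻¹ • x)).mulVec (weakDeriv Ω β (weakDeriv Ω γ u₀) x).ofLp)

/-- The product rule applies to each `χ γ (x/ε)`, bounded with bounded derivatives by periodicity,
times `∂_γ u₀`, which is in `H¹` because `u₀` is in `H²`. -/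
lemma hasWeakDeriv_firstCorrector (hΩ : Bornology.IsBounded (Ω : Set Plane))
    (hχ : IsCellCorrector A χ) (hu : MemH2 Ω u₀) (ε : ℝ) (β : Fin 2) :
    HasWeakDeriv Ω β (firstCorrector Ω χ ε u₀) (firstCorrectorDeriv Ω χ ε u₀ β) := by
  have hM : ∀ γ i j, ContDiff ℝ 1 fun y : Plane => χ γ (ε⁻¹ • y) i j := fun γ i j =>
    ((hχ.contDiff γ i j).of_le (by norm_num)).comp (contDiff_const_smul _)
  have hper : ∀ γ i j, IsPeriodic fun y => χ γ y i j := fun γ i j y l => by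
    simp only [hχ.periodic γ y l]
  obtain ⟨K, -, hK⟩ := exists_uniform_bound
    (f := fun (m : Fin 2 × Fin N × Fin N) y => χ m.1 y m.2.1 m.2.2)
    (fun m => hper _ _ _) (fun m => (hχ.contDiff _ _ _).continuous)
  obtain ⟨K', -, hK'⟩ := exists_uniform_bound
    (f := fun (m : Fin 2 × Fin N × Fin N) => pd β fun y => χ m.1 y m.2.1 m.2.2)
    (fun m => (hper _ _ _).pd β) (fun m => (hχ.contDiff_pd β _ _ _).continuous)
  have hpd : ∀ γ x, pdMatrix β (fun y => χ γ (ε⁻¹ • y)) x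
      = ε⁻¹ • pdMatrix β (χ γ) (ε⁻¹ • x) := by
    intro γ x
    ext i j
    exact pd_comp_smul ((hχ.contDiff γ i j).differentiable (by norm_num)) ε⁻¹ β x
  have key := fun γ => ((hu.2 γ).hasWeakDeriv β).mulVec hΩ (hM γ) (K := K) (K' := |ε⁻¹| * K')
    (fun i j x => hK (γ, i, j) _) (fun i j x => by
      rw [hpd, Matrix.smul_apply, smul_eq_mul, abs_mul]
      exact mul_le_mul_of_nonneg_left (hK' (γ, i, j) _) (abs_nonneg _))
  simp only [hpd] at key
  have := (key 0).add (key 1)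
  unfold firstCorrector firstCorrectorDeriv
  simpa only [Fin.sum_univ_two] using this

lemma memH1_firstCorrector (hΩ : Bornology.IsBounded (Ω : Set Plane))
    (hχ : IsCellCorrector A χ) (hu : MemH2 Ω u₀) (ε : ℝ) :
    MemH1 Ω (firstCorrector Ω χ ε u₀) :=
  fun β => ⟨_, hasWeakDeriv_firstCorrector hΩ hχ hu ε β⟩

/-- The rotation by a quarter turn. -/
def rotation : Matrix (Fin 2) (Fin 2) ℝ := !![0, 1; -1, 0]

/-- The coefficients `rot^{αβ} Ψ^γ - A^{αβ} χ^γ`. -/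
def remainderCoeff (A : Coeff N) (χ Ψ : Fin 2 → Plane → Matrix (Fin N) (Fin N) ℝ) (γ : Fin 2) :
    Coeff N := fun y α β => rotation α β • Ψ γ y - A y α β * χ γ y

lemma flux_sub_coeff (B B' : Coeff N) (p : Fin 2 → Plane → Vec N) :
    flux (fun x α β => B x α β - B' x α β) p = flux B p - flux B' p := by
  funext α x
  ext i
  simp [flux, Matrix.sub_mulVec]

/-- Pointwise algebra: the `ε⁻¹` of the chain rule cancels `ε`, so the terms without second
derivatives of `u₀` assemble into the flux corrector. -/
lemma flux_homogenized_sub (hε : ε ≠ 0) :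
    flux (homogenized A χ) (weakGrad Ω u₀) - flux (oscillating A ε) (weakGrad Ω u₀)
      - ε • flux (oscillating A ε) (firstCorrectorDeriv Ω χ ε u₀)
    = (-1 : ℝ) • flux (oscillating (fluxCorrector A χ) ε) (weakGrad Ω u₀)
      - ε • ∑ γ, flux (oscillating (fun y α β => A y α β * χ γ y) ε)
          (weakGrad Ω (weakDeriv Ω γ u₀)) := by
  -- The homogenized tensor occurs both at `x` and at `x/ε`; naming its constant value identifies
  -- the two.
  obtain ⟨A₀, h₀⟩ : ∃ A₀, ∀ y, homogenized A χ y = A₀ := ⟨_, fun _ => rfl⟩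
  funext α x
  apply (WithLp.ofLp_injective 2)
  simp only [flux, oscillating, fluxCorrector, weakGrad, firstCorrectorDeriv, Fin.sum_univ_two,
    h₀, Pi.sub_apply, Pi.smul_apply, Pi.add_apply, WithLp.ofLp_sub, WithLp.ofLp_smul,
    WithLp.ofLp_add, Matrix.mulVec_add, Matrix.mulVec_smul, Matrix.smul_mulVec,
    Matrix.mulVec_mulVec, Matrix.add_mulVec, Matrix.sub_mulVec, smul_add, smul_smul,
    mul_inv_cancel₀ hε, one_smul]
  module

/-- The divergence-free part of the flux is moved onto the second derivatives of `u₀`. -/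
lemma pairing_fluxCorrector (hΩ : Bornology.IsBounded (Ω : Set Plane)) (hu : MemH2 Ω u₀)
    (hε : ε ≠ 0) (hΨ : ∀ γ i j, ContDiff ℝ 1 fun y => Ψ γ y i j)
    (h1 : ∀ γ i j y, pd 1 (fun y => Ψ γ y i j) y = fluxCorrector A χ y 0 γ i j)
    (h0 : ∀ γ i j y, pd 0 (fun y => Ψ γ y i j) y = -fluxCorrector A χ y 1 γ i j)
    (φ : 𝓓(Ω, Vec N)) :
    pairing Ω (flux (oscillating (fluxCorrector A χ) ε) (weakGrad Ω u₀)) (fun α => pd α φ)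
      = -ε * ∑ γ, pairing Ω (flux (oscillating (fun y α β => rotation α β • Ψ γ y) ε)
          (weakGrad Ω (weakDeriv Ω γ u₀))) (fun α => pd α φ) := by
  set ψ : Fin 2 → Fin N → Fin N → Plane → ℝ := fun γ i k x => Ψ γ (ε⁻¹ • x) i k with hψ
  set η : Fin N → Plane → ℝ := fun i x => φ x i with hη
  have hψ1 : ∀ γ i k, ContDiff ℝ 1 (ψ γ i k) := fun γ i k =>
    (hΨ γ i k).comp (contDiff_const_smul _)
  have hφd : Differentiable ℝ φ := φ.contDiff.differentiable (by simp)
  have hη1 : ∀ i, ContDiff ℝ ∞ (η i) := fun i =>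
    (EuclideanSpace.proj (𝕜 := ℝ) i).contDiff.comp φ.contDiff
  have hsupp : ∀ i, Function.support (η i) ⊆ Function.support φ := by
    intro i x hx hx0
    exact hx (by simp [hη, hx0])
  have hηc : ∀ i, HasCompactSupport (η i) := fun i => φ.hasCompactSupport.mono (hsupp i)
  have hηs : ∀ i, tsupport (η i) ⊆ Ω := fun i =>
    (closure_mono (hsupp i)).trans φ.tsupport_subset
  have hηpd : ∀ α i x, pd α (η i) x = pd α φ x i := fun α i x => pd_apply_coord (hφd x) α i
  -- The gain of one power of `ε`: a derivative of `Ψ` at `x/ε` is `ε` times the derivative of the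
  -- rescaled function.
  have hb0 : ∀ γ i k x, fluxCorrector A χ (ε⁻¹ • x) 0 γ i k = ε * pd 1 (ψ γ i k) x := by
    intro γ i k x
    rw [hψ, pd_comp_smul ((hΨ γ i k).differentiable one_ne_zero), h1, ← mul_assoc,
      mul_inv_cancel₀ hε, one_mul]
  have hb1 : ∀ γ i k x, fluxCorrector A χ (ε⁻¹ • x) 1 γ i k = -(ε * pd 0 (ψ γ i k) x) := by
    intro γ i k x
    rw [hψ, pd_comp_smul ((hΨ γ i k).differentiable one_ne_zero), h0, ← mul_assoc,
      mul_inv_cancel₀ hε, one_mul, neg_neg]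
  have key := fun γ i k => integral_stream_function hΩ ((hu.2 γ).hasWeakDeriv 0)
    ((hu.2 γ).hasWeakDeriv 1) (hψ1 γ i k) (hη1 i) (hηc i) (hηs i) k
  have hcη : ∀ α i, Continuous (pd α (η i)) := fun α i => continuous_pd (hη1 i) (by simp) α
  have hcψ : ∀ α γ i k, Continuous (pd α (ψ γ i k)) := fun α γ i k =>
    continuous_pd (hψ1 γ i k) one_ne_zero α
  have int1 : ∀ γ i k, Integrable (fun x => (pd 1 (ψ γ i k) x * pd 0 (η i) x
      - pd 0 (ψ γ i k) x * pd 1 (η i) x) * weakDeriv Ω γ u₀ x k)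
      (volume.restrict (Ω : Set Plane)) := by
    intro γ i k
    refine integrable_mul_of_memLp_two (memLp_of_continuous_hasCompactSupport
      (((hcψ 1 γ i k).mul (hcη 0 i)).sub ((hcψ 0 γ i k).mul (hcη 1 i))) ?_ Ω)
      (((hu.2 γ).memLp).eval_piLp k)
    exact ((hasCompactSupport_pd (hηc i) 0).mul_left).sub
      ((hasCompactSupport_pd (hηc i) 1).mul_left)
  have int2 : ∀ γ i k, Integrable (fun x => ψ γ i k x
      * (pd 0 (η i) x * weakDeriv Ω 1 (weakDeriv Ω γ u₀) x k
        - pd 1 (η i) x * weakDeriv Ω 0 (weakDeriv Ω γ u₀) x k))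
      (volume.restrict (Ω : Set Plane)) := by
    intro γ i k
    have m := fun α => memLp_of_continuous_hasCompactSupport
      ((hψ1 γ i k).continuous.mul (hcη α i)) (hasCompactSupport_pd (hηc i) α).mul_left Ω
    refine ((integrable_mul_of_memLp_two (m 0)
      (((hu.2 γ).memLp_weakDeriv 1).eval_piLp k)).sub (integrable_mul_of_memLp_two (m 1)
      (((hu.2 γ).memLp_weakDeriv 0).eval_piLp k))).congr (Filter.Eventually.of_forall fun x => ?_)
    simp only [Pi.sub_apply, Pi.mul_apply]
    ring
  have lhs : pairing Ω (flux (oscillating (fluxCorrector A χ) ε) (weakGrad Ω u₀))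
      (fun α => pd α φ) = ∑ γ, ∑ i, ∑ k, ε * ∫ x in (Ω : Set Plane),
        (pd 1 (ψ γ i k) x * pd 0 (η i) x - pd 0 (ψ γ i k) x * pd 1 (η i) x)
          * weakDeriv Ω γ u₀ x k := by
    simp only [← integral_const_mul]
    simp only [← integral_finsetSum Finset.univ fun k _ => (int1 _ _ k).const_mul ε]
    simp only [← integral_finsetSum Finset.univ fun i _ =>
      integrable_finsetSum Finset.univ fun k _ => (int1 _ i k).const_mul ε]
    rw [← integral_finsetSum Finset.univ fun γ _ => integrable_finsetSum Finset.univ fun i _ =>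
      integrable_finsetSum Finset.univ fun k _ => (int1 γ i k).const_mul ε]
    refine integral_congr_ae (Filter.Eventually.of_forall fun x => ?_)
    simp only [flux_apply, Fin.sum_univ_two, oscillating, weakGrad, hb0, hb1, hηpd, add_mul,
      Finset.sum_mul, ← Finset.sum_add_distrib]
    refine Finset.sum_congr rfl fun i _ => Finset.sum_congr rfl fun k _ => ?_
    ring
  have rhs : ∀ γ, pairing Ω (flux (oscillating (fun y α β => rotation α β • Ψ γ y) ε)
      (weakGrad Ω (weakDeriv Ω γ u₀))) (fun α => pd α φ)
      = ∑ i, ∑ k, ∫ x in (Ω : Set Plane), ψ γ i k x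
      * (pd 0 (η i) x * weakDeriv Ω 1 (weakDeriv Ω γ u₀) x k
        - pd 1 (η i) x * weakDeriv Ω 0 (weakDeriv Ω γ u₀) x k) := by
    intro γ
    simp only [← integral_finsetSum Finset.univ fun k _ => int2 _ _ k]
    rw [← integral_finsetSum Finset.univ fun i _ =>
      integrable_finsetSum Finset.univ fun k _ => int2 γ i k]
    refine integral_congr_ae (Filter.Eventually.of_forall fun x => ?_)
    simp only [flux_apply, Fin.sum_univ_two, oscillating, weakGrad, hηpd, add_mul,
      Finset.sum_mul, ← Finset.sum_add_distrib]
    refine Finset.sum_congr rfl fun i _ => Finset.sum_congr rfl fun k _ => ?_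
    simp [rotation, hψ]
    ring
  rw [lhs, Finset.mul_sum]
  refine Finset.sum_congr rfl fun γ _ => ?_
  rw [rhs]
  simp only [key, Finset.mul_sum]
  refine Finset.sum_congr rfl fun i _ => Finset.sum_congr rfl fun k _ => ?_
  ring

end Remainder

/-! ### Sobolev norms and Poincaré's inequality -/

section Norms

variable {N : ℕ} {Ω : Opens Plane} {u v r : Plane → Vec N}

lemma MemH1.weakGrad_sub (hu : MemH1 Ω u) (hv : MemH1 Ω v) (α : Fin 2) :
    weakGrad Ω (fun x => u x - v x) α =ᵐ[volume.restrict (Ω : Set Plane)]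
      (weakGrad Ω u - weakGrad Ω v) α :=
  hu.weakDeriv_sub hv α

lemma h1Norm_nonneg (u : Plane → Vec N) : 0 ≤ h1Norm Ω u := Real.sqrt_nonneg _

lemma h1Norm_sq (u : Plane → Vec N) :
    h1Norm Ω u ^ 2 = (∫ x in (Ω : Set Plane), ‖u x‖ ^ 2) + fieldNorm Ω (weakGrad Ω u) ^ 2 := by
  rw [fieldNorm_sq, h1Norm, Real.sq_sqrt]
  · rfl
  · exact add_nonneg (integral_norm_sq_nonneg u)
      (Finset.sum_nonneg fun α _ => integral_norm_sq_nonneg _)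

lemma fieldNorm_weakGrad_le (u : Plane → Vec N) : fieldNorm Ω (weakGrad Ω u) ≤ h1Norm Ω u := by
  refine abs_le_of_sq_le_sq' ?_ (h1Norm_nonneg u) |>.2
  rw [h1Norm_sq]
  linarith [integral_norm_sq_nonneg (Ω := Ω) u]

lemma fieldNorm_weakGrad_weakDeriv_le (u : Plane → Vec N) (γ : Fin 2) :
    fieldNorm Ω (weakGrad Ω (weakDeriv Ω γ u)) ≤ h2Norm Ω u := by
  refine Real.sqrt_le_sqrt ?_
  have h1 := integral_norm_sq_nonneg (Ω := Ω) u
  have h2 : 0 ≤ ∑ α : Fin 2, ∫ x in (Ω : Set Plane), ‖weakDeriv Ω α u x‖ ^ 2 :=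
    Finset.sum_nonneg fun α _ => integral_norm_sq_nonneg _
  have h3 : ∑ α, ∫ x in (Ω : Set Plane), ‖weakDeriv Ω α (weakDeriv Ω γ u) x‖ ^ 2
      ≤ ∑ α, ∑ β, ∫ x in (Ω : Set Plane), ‖weakDeriv Ω α (weakDeriv Ω β u) x‖ ^ 2 :=
    Finset.sum_le_sum fun α _ => Finset.single_le_sum
      (f := fun β => ∫ x in (Ω : Set Plane), ‖weakDeriv Ω α (weakDeriv Ω β u) x‖ ^ 2)
      (fun β _ => integral_norm_sq_nonneg _) (Finset.mem_univ γ)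
  exact h3.trans (by linarith)

lemma integral_norm_sub_sq_le {f h : Plane → Vec N} {μ : Measure Plane} (hf : MemLp f 2 μ)
    (hh : MemLp h 2 μ) :
    ∫ x, ‖f x - h x‖ ^ 2 ∂μ ≤ 2 * (∫ x, ‖f x‖ ^ 2 ∂μ) + 2 * ∫ x, ‖h x‖ ^ 2 ∂μ := by
  have i1 := (integrable_norm_sq hf).const_mul 2
  have i2 := (integrable_norm_sq hh).const_mul 2
  rw [← integral_const_mul, ← integral_const_mul, ← integral_add i1 i2]
  refine integral_mono (integrable_norm_sq (hf.sub hh)) (i1.add i2) fun x => ?_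
  have := norm_sub_le (f x) (h x)
  have h0 := norm_nonneg (f x - h x)
  simp only
  nlinarith [sq_nonneg (‖f x‖ - ‖h x‖)]

lemma fieldNorm_sub_sq_le {p q : Fin 2 → Plane → Vec N} (hp : MemL2Field Ω p)
    (hq : MemL2Field Ω q) :
    fieldNorm Ω (p - q) ^ 2 ≤ 2 * fieldNorm Ω p ^ 2 + 2 * fieldNorm Ω q ^ 2 := by
  rw [fieldNorm_sq, fieldNorm_sq, fieldNorm_sq, Finset.mul_sum, Finset.mul_sum,
    ← Finset.sum_add_distrib]
  exact Finset.sum_le_sum fun α _ => integral_norm_sub_sq_le (hp α) (hq α)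

lemma fieldNorm_congr {p q : Fin 2 → Plane → Vec N}
    (h : ∀ α, p α =ᵐ[volume.restrict (Ω : Set Plane)] q α) : fieldNorm Ω p = fieldNorm Ω q := by
  rw [fieldNorm, fieldNorm]
  congr 1
  refine Finset.sum_congr rfl fun α _ => integral_congr_ae ?_
  filter_upwards [h α] with x hx
  rw [hx]

lemma h1Norm_sub_sq_le (hu : MemH1 Ω u) (hv : MemH1 Ω v) :
    h1Norm Ω (fun x => u x - v x) ^ 2 ≤ 2 * h1Norm Ω u ^ 2 + 2 * h1Norm Ω v ^ 2 := by
  have h1 := integral_norm_sub_sq_le hu.memLp hv.memLp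
  have h2 := fieldNorm_sub_sq_le hu.memL2Field hv.memL2Field
  rw [h1Norm_sq, h1Norm_sq, h1Norm_sq, fieldNorm_congr (q := weakGrad Ω u - weakGrad Ω v)
    (hu.weakGrad_sub hv)]
  linarith

lemma h1Norm_const_smul (hu : MemH1 Ω u) (c : ℝ) :
    h1Norm Ω (fun x => c • u x) = |c| * h1Norm Ω u := by
  have h0 : ∀ α, ∫ x in (Ω : Set Plane), ‖weakDeriv Ω α (fun x => c • u x) x‖ ^ 2
      = |c| ^ 2 * ∫ x in (Ω : Set Plane), ‖weakDeriv Ω α u x‖ ^ 2 := by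
    intro α
    rw [← integral_const_mul]
    refine integral_congr_ae ?_
    filter_upwards [hu.weakDeriv_const_smul c α] with x hx
    rw [hx, norm_smul, mul_pow, Real.norm_eq_abs]
  have h1 : ∫ x in (Ω : Set Plane), ‖c • u x‖ ^ 2
      = |c| ^ 2 * ∫ x in (Ω : Set Plane), ‖u x‖ ^ 2 := by
    simp only [norm_smul, mul_pow, Real.norm_eq_abs, integral_const_mul]
  rw [h1Norm, h1Norm, h1]
  simp only [h0]
  rw [← Finset.mul_sum, ← mul_add, Real.sqrt_mul (by positivity), Real.sqrt_sq (abs_nonneg c)]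

/-! ### The space `H¹₀` and Poincaré's inequality. -/

lemma MemH10.sub (hu : MemH10 Ω u) (hv : MemH10 Ω v) : MemH10 Ω (fun x => u x - v x) := by
  refine ⟨hu.1.sub hv.1, fun δ hδ => ?_⟩
  obtain ⟨φ, hφ⟩ := hu.2 (δ / 2) (by positivity)
  obtain ⟨ψ, hψ⟩ := hv.2 (δ / 2) (by positivity)
  refine ⟨φ - ψ, ?_⟩
  have e : (fun x => u x - v x - (φ - ψ) x) = fun x => (u x - φ x) - (v x - ψ x) := by
    funext x
    rw [sub_apply]
    abel
  rw [e]
  have := h1Norm_sub_sq_le (hu.1.sub (memH1_testFunction φ)) (hv.1.sub (memH1_testFunction ψ))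
  refine lt_of_pow_lt_pow_left₀ 2 hδ.le (this.trans_lt ?_)
  have a := pow_lt_pow_left₀ hφ (h1Norm_nonneg _) two_ne_zero
  have b := pow_lt_pow_left₀ hψ (h1Norm_nonneg _) two_ne_zero
  linarith

lemma MemH10.const_smul (hu : MemH10 Ω u) {c : ℝ} (hc : c ≠ 0) :
    MemH10 Ω (fun x => c • u x) := by
  refine ⟨hu.1.const_smul c, fun δ hδ => ?_⟩
  obtain ⟨φ, hφ⟩ := hu.2 (δ / |c|) (by positivity)
  refine ⟨c • φ, ?_⟩
  have e : (fun x => c • u x - (c • φ) x) = fun x => c • (u x - φ x) := by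
    funext x
    rw [smul_apply, smul_sub]
  rw [e, h1Norm_const_smul (hu.1.sub (memH1_testFunction φ)), mul_comm]
  exact (lt_div_iff₀ (by positivity)).1 hφ

lemma memH10_testFunction (φ : 𝓓(Ω, Vec N)) : MemH10 Ω φ := by
  refine ⟨memH1_testFunction φ, fun δ hδ => ⟨φ, ?_⟩⟩
  -- `φ` approximates itself; the norm of the zero function vanishes by homogeneity with factor `0`.
  have := h1Norm_const_smul (memH1_testFunction φ) 0
  simp only [zero_smul, abs_zero, zero_mul] at this
  simpa [this] using hδ

lemma norm_fderiv_le (f : Plane → Vec N) (x : Plane) : ‖fderiv ℝ f x‖ ≤ ∑ α, ‖pd α f x‖ := by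
  refine ContinuousLinearMap.opNorm_le_bound _ (Finset.sum_nonneg fun α _ => norm_nonneg _) ?_
  intro v
  have hv : v = ∑ α, v α • EuclideanSpace.single α (1 : ℝ) := by
    ext k
    fin_cases k <;> simp
  conv_lhs => rw [hv]
  rw [map_sum, Finset.sum_mul]
  refine (norm_sum_le _ _).trans (Finset.sum_le_sum fun α _ => ?_)
  rw [map_smul, norm_smul, mul_comm]
  exact mul_le_mul_of_nonneg_left (PiLp.norm_apply_le v α) (norm_nonneg _)

/-- In the plane the critical Sobolev inequality bounds the `L²` norm by the `L¹` norm of the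
gradient, and Cauchy–Schwarz on a set of finite measure `V` passes to the `L²` norm of the gradient.
The constant is `2c²V`, the `2` coming from the two partial derivatives. -/
lemma exists_poincare_testFunction (N : ℕ) (hΩ : Bornology.IsBounded (Ω : Set Plane)) :
    ∃ C : ℝ, 0 ≤ C ∧ ∀ φ : 𝓓(Ω, Vec N),
      ∫ x in (Ω : Set Plane), ‖φ x‖ ^ 2 ≤ C * fieldNorm Ω (fun α => pd α φ) ^ 2 := by
  have := isFiniteMeasure_restrict_of_isBounded hΩ
  set c : ℝ :=
    ((eLpNormLESNormFDerivOneConst (volume : Measure Plane) (2 : NNReal) : NNReal) : ℝ) with hc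
  have hc0 : 0 ≤ c := NNReal.coe_nonneg _
  set V : ℝ := volume.real (Ω : Set Plane) with hV
  have hV0 : 0 ≤ V := measureReal_nonneg
  refine ⟨2 * c ^ 2 * V, by positivity, fun φ => ?_⟩
  have hφ1 : ContDiff ℝ 1 φ := φ.contDiff.of_le (by simp)
  have hpd : ∀ α, MemLp (pd α φ) 2 (volume.restrict (Ω : Set Plane)) := fun α =>
    (hasWeakDeriv_testFunction φ α).memLp_deriv
  have hpd1 : ∀ α, Integrable (fun x => ‖pd α φ x‖) (volume.restrict (Ω : Set Plane)) := fun α =>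
    ((hpd α).integrable (by norm_num)).norm
  have hfc : Continuous (fderiv ℝ φ) := hφ1.continuous_fderiv one_ne_zero
  have hfs : HasCompactSupport (fderiv ℝ φ) := φ.hasCompactSupport.fderiv ℝ
  have hfi : Integrable (fderiv ℝ φ) volume := hfc.integrable_of_hasCompactSupport hfs
  have h1 : eLpNorm φ 2 volume
      ≤ eLpNormLESNormFDerivOneConst (volume : Measure Plane) (2 : NNReal)
        * eLpNorm (fderiv ℝ φ) 1 volume :=
    eLpNorm_le_eLpNorm_fderiv_one volume hφ1 φ.hasCompactSupport (p := 2) (by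
      rw [finrank_euclideanSpace, Fintype.card_fin, Nat.cast_ofNat]
      exact ⟨by norm_num [← two_mul], by norm_num, by norm_num⟩)
  have hm : MemLp φ 2 volume := φ.continuous.memLp_of_hasCompactSupport φ.hasCompactSupport
  rw [hm.eLpNorm_eq_integral_rpow_norm (by norm_num) (by norm_num),
    (memLp_one_iff_integrable.2 hfi).eLpNorm_eq_integral_rpow_norm (by norm_num) (by norm_num),
    ← ENNReal.ofReal_coe_nnreal, ← ENNReal.ofReal_mul hc0] at h1
  have h2 := (ENNReal.ofReal_le_ofReal_iff (mul_nonneg hc0 (Real.rpow_nonneg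
    (integral_nonneg fun _ => Real.rpow_nonneg (norm_nonneg _) _) _))).1 h1
  simp only [ENNReal.toReal_ofNat, Real.rpow_ofNat, ENNReal.toReal_one, Real.rpow_one,
    inv_one] at h2
  have h3 : ∫ x, ‖fderiv ℝ φ x‖ ≤ ∑ α, Real.sqrt V
      * Real.sqrt (∫ x in (Ω : Set Plane), ‖pd α φ x‖ ^ 2) := by
    rw [← setIntegral_eq_integral_of_tsupport_subset (φ := fderiv ℝ φ) (s := (Ω : Set Plane))
      ((tsupport_fderiv_subset ℝ).trans φ.tsupport_subset) (fun x hx => by rw [hx, norm_zero])]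
    refine (integral_mono hfi.restrict.norm (integrable_finsetSum _ fun α _ => hpd1 α)
      fun x => norm_fderiv_le φ x).trans ?_
    rw [integral_finsetSum _ fun α _ => hpd1 α]
    refine Finset.sum_le_sum fun α _ => ?_
    have := integral_norm_mul_norm_le (memLp_const (1 : ℝ)) (hpd α).norm
    simpa [V] using this
  have h4 : Real.sqrt (∫ x, ‖φ x‖ ^ 2) ≤ c * (Real.sqrt V * ∑ α,
      Real.sqrt (∫ x in (Ω : Set Plane), ‖pd α φ x‖ ^ 2)) := by
    rw [Real.sqrt_eq_rpow, one_div, Finset.mul_sum]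
    exact h2.trans (mul_le_mul_of_nonneg_left h3 hc0)
  rw [setIntegral_eq_integral_of_tsupport_subset φ.tsupport_subset (fun x hx => by simp [hx]),
    ← Real.sq_sqrt (integral_nonneg fun x => by positivity : 0 ≤ ∫ x, ‖φ x‖ ^ 2)]
  refine (pow_le_pow_left₀ (Real.sqrt_nonneg _) h4 2).trans ?_
  rw [mul_pow, mul_pow, Real.sq_sqrt hV0, fieldNorm_sq, Fin.sum_univ_two, Fin.sum_univ_two]
  have s0 := Real.sq_sqrt (integral_norm_sq_nonneg (Ω := Ω) (pd 0 φ))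
  have s1 := Real.sq_sqrt (integral_norm_sq_nonneg (Ω := Ω) (pd 1 φ))
  rw [← s0, ← s1, mul_comm 2 (c ^ 2), mul_assoc (c ^ 2), mul_assoc (c ^ 2), mul_comm 2 V,
    mul_assoc V]
  refine mul_le_mul_of_nonneg_left (mul_le_mul_of_nonneg_left ?_ hV0) (sq_nonneg c)
  rw [s0, s1]
  nlinarith [sq_nonneg (Real.sqrt (∫ x in (Ω : Set Plane), ‖pd 0 φ x‖ ^ 2)
    - Real.sqrt (∫ x in (Ω : Set Plane), ‖pd 1 φ x‖ ^ 2))]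

/-- Poincaré's inequality in `H¹₀`. -/
lemma exists_poincare (N : ℕ) (hΩ : Bornology.IsBounded (Ω : Set Plane)) :
    ∃ C : ℝ, 0 ≤ C ∧ ∀ r : Plane → Vec N, MemH10 Ω r →
      ∫ x in (Ω : Set Plane), ‖r x‖ ^ 2 ≤ C * fieldNorm Ω (weakGrad Ω r) ^ 2 := by
  obtain ⟨C, hC, h⟩ := exists_poincare_testFunction N hΩ
  refine ⟨4 * C, by positivity, fun r hr => le_of_forall_pos_le_add fun η hη => ?_⟩
  -- With `d = r - φ`, splitting `r = d + φ` costs `2‖d‖²`, and splitting `∇φ = ∇r - ∇d` costs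
  -- `4C‖∇d‖²`; together at most `(4C + 2)` times the squared `H¹` norm of `d`.
  have hM : 0 < 4 * C + 2 := by positivity
  obtain ⟨φ, hφ⟩ := hr.2 (Real.sqrt (η / (4 * C + 2))) (Real.sqrt_pos.2 (by positivity))
  have hφH := memH1_testFunction φ
  have hd := hr.1.sub hφH
  have hsq : h1Norm Ω (fun x => r x - φ x) ^ 2 ≤ η / (4 * C + 2) := by
    rw [← Real.sq_sqrt (show 0 ≤ η / (4 * C + 2) by positivity)]
    exact pow_le_pow_left₀ (h1Norm_nonneg _) hφ.le 2
  have hηM : (4 * C + 2) * (η / (4 * C + 2)) = η := mul_div_cancel₀ _ hM.ne'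
  have b0 := h1Norm_sq (Ω := Ω) (fun x => r x - φ x)
  have b1 := integral_norm_sq_nonneg (Ω := Ω) (fun x => r x - φ x)
  have b2 := sq_nonneg (fieldNorm Ω (weakGrad Ω fun x => r x - φ x))
  have c1 := integral_norm_sub_sq_le hd.memLp (hφH.const_smul (-1)).memLp
  simp only [neg_smul, one_smul, sub_neg_eq_add, sub_add_cancel, norm_neg] at c1
  have c2 : fieldNorm Ω (fun α => pd α φ) ^ 2 ≤ 2 * fieldNorm Ω (weakGrad Ω r) ^ 2
      + 2 * fieldNorm Ω (weakGrad Ω fun x => r x - φ x) ^ 2 := by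
    rw [fieldNorm_congr (q := weakGrad Ω r - weakGrad Ω fun x => r x - φ x)]
    · exact fieldNorm_sub_sq_le hr.1.memL2Field hd.memL2Field
    · intro α
      filter_upwards [(hasWeakDeriv_testFunction φ α).weakDeriv_ae_eq,
        hr.1.weakDeriv_sub hφH α] with x h1 h2
      simp only [weakGrad, Pi.sub_apply, h2, h1, sub_sub_cancel]
  have c3 := h φ
  have c4 := mul_le_mul_of_nonneg_left c2 hC
  have c5 : C * fieldNorm Ω (weakGrad Ω fun x => r x - φ x) ^ 2 ≤ C * (η / (4 * C + 2)) :=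
    mul_le_mul_of_nonneg_left (by linarith) hC
  linarith

/-- By Cauchy–Schwarz the pairing with `∇r` is continuous in the `H¹` norm, for which test functions
are dense in `H¹₀`. -/
lemma pairing_eq_zero_of_testFunction {G : Fin 2 → Plane → Vec N} (hG : MemL2Field Ω G)
    (h : ∀ φ : 𝓓(Ω, Vec N), pairing Ω G (weakGrad Ω φ) = 0) (hr : MemH10 Ω r) :
    pairing Ω G (weakGrad Ω r) = 0 := by
  rw [← abs_nonpos_iff]
  refine le_of_forall_pos_le_add fun η hη => ?_
  have hM : 0 < fieldNorm Ω G + 1 := by linarith [fieldNorm_nonneg (Ω := Ω) G]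
  obtain ⟨φ, hφ⟩ := hr.2 (η / (fieldNorm Ω G + 1)) (by positivity)
  have hφH := memH1_testFunction φ
  have e : pairing Ω G (weakGrad Ω r) = pairing Ω G (weakGrad Ω fun x => r x - φ x) := by
    rw [pairing_congr (p' := G) (fun _ => Filter.EventuallyEq.rfl) (hr.1.weakGrad_sub hφH),
      pairing_sub_right hG hr.1.memL2Field hφH.memL2Field, h, sub_zero]
  rw [e, zero_add]
  refine (abs_pairing_le hG (hr.1.sub hφH).memL2Field).trans ?_
  have h1 := (fieldNorm_weakGrad_le (Ω := Ω) fun x => r x - φ x).trans hφ.le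
  refine (mul_le_mul_of_nonneg_left h1 (fieldNorm_nonneg G)).trans ?_
  rw [mul_div_assoc', div_le_iff₀ hM]
  nlinarith

end Norms

/-! ### The energy estimate -/

section Estimate

variable {N : ℕ} {Ω : Opens Plane} {A : Coeff N}
  {χ Ψ : Fin 2 → Plane → Matrix (Fin N) (Fin N) ℝ} {u₀ u ϑ : Plane → Vec N} {ε : ℝ}

lemma isBoundedCoeff_homogenized (A : Coeff N)
    (χ : Fin 2 → Plane → Matrix (Fin N) (Fin N) ℝ) : ∃ K, IsBoundedCoeff (homogenized A χ) K := by
  obtain ⟨K, -, h⟩ := exists_isBoundedCoeff (B := homogenized A χ) (fun _ _ => rfl)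
    (fun _ _ _ _ => continuous_const)
  exact ⟨K, h 1⟩

/-- The remainder `u^ε - u⁰ - ε u¹(·, ·/ε) - ε ϑ^ε`. -/
def remainder (Ω : Opens Plane) (χ : Fin 2 → Plane → Matrix (Fin N) (Fin N) ℝ) (ε : ℝ)
    (u₀ u ϑ : Plane → Vec N) : Plane → Vec N :=
  fun x => u x - u₀ x - ε • firstCorrector Ω χ ε u₀ x - ε • ϑ x

/-- The field `F` such that the remainder solves `-∇·A(x/ε)∇r = -ε ∇·F`. -/
def remainderFlux (Ω : Opens Plane) (A : Coeff N)
    (χ Ψ : Fin 2 → Plane → Matrix (Fin N) (Fin N) ℝ) (ε : ℝ) (u₀ : Plane → Vec N) :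
    Fin 2 → Plane → Vec N :=
  ∑ γ, flux (oscillating (remainderCoeff A χ Ψ γ) ε) (weakGrad Ω (weakDeriv Ω γ u₀))

/-- Both equations carry the same `f` and `ϑ` contributes nothing, so only the flux mismatch
survives. It is stated for test functions because moving the derivatives off `Ψ` uses second
derivatives of `φ`. -/
lemma energyForm_remainder (hΩ : Bornology.IsBounded (Ω : Set Plane)) (hAp : IsPeriodic A)
    (hA : IsSmoothCoeff A) (hχ : IsCellCorrector A χ) (hu₀ : MemH2 Ω u₀) (hε : ε ≠ 0)
    (hΨ : ∀ γ i j, ContDiff ℝ 1 fun y => Ψ γ y i j)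
    (hΨp : ∀ γ i j, IsPeriodic fun y => Ψ γ y i j)
    (h1 : ∀ γ i j y, pd 1 (fun y => Ψ γ y i j) y = fluxCorrector A χ y 0 γ i j)
    (h0 : ∀ γ i j y, pd 0 (fun y => Ψ γ y i j) y = -fluxCorrector A χ y 1 γ i j)
    (hu : MemH1 Ω u) (hϑ : MemH1 Ω ϑ) (φ : 𝓓(Ω, Vec N))
    (heq : energyForm Ω (oscillating A ε) u φ = energyForm Ω (homogenized A χ) u₀ φ)
    (hϑeq : energyForm Ω (oscillating A ε) ϑ φ = 0) :
    energyForm Ω (oscillating A ε) (remainder Ω χ ε u₀ u ϑ) φ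
      = ε * pairing Ω (remainderFlux Ω A χ Ψ ε u₀) (weakGrad Ω φ) := by
  obtain ⟨K, -, hK⟩ := exists_isBoundedCoeff hAp fun α β i j => (hA α β i j).continuous
  obtain ⟨K₀, hK₀⟩ := isBoundedCoeff_homogenized A χ
  have hKr : ∀ γ, ∃ K, IsBoundedCoeff (oscillating (fun y α β => rotation α β • Ψ γ y) ε) K := by
    intro γ
    obtain ⟨K, -, h⟩ := exists_isBoundedCoeff (B := fun y α β => rotation α β • Ψ γ y)
      (fun y l => by
        funext α β
        ext i j
        simp only [Matrix.smul_apply, hΨp γ i j y l])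
      (fun α β i j => continuous_const.mul (hΨ γ i j).continuous)
    exact ⟨K, h ε⟩
  have hKχ : ∀ γ, ∃ K, IsBoundedCoeff (oscillating (fun y α β => A y α β * χ γ y) ε) K := by
    intro γ
    obtain ⟨K, -, h⟩ := exists_isBoundedCoeff (B := fun y α β => A y α β * χ γ y)
      (fun y l => by simp only [hAp y l, hχ.periodic γ y l])
      (fun α β i j => by
        simp only [Matrix.mul_apply]
        exact continuous_finsetSum _ fun k _ =>
          (hA α β i k).continuous.mul (hχ.contDiff γ k j).continuous)
    exact ⟨K, h ε⟩
  have hKb : ∃ K, IsBoundedCoeff (oscillating (fluxCorrector A χ) ε) K := by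
    obtain ⟨K, -, h⟩ := exists_isBoundedCoeff (B := fluxCorrector A χ)
      (fun y l => by
        funext α γ
        ext i j
        exact isPeriodic_fluxCorrector hAp hχ α γ i j y l)
      (fun α γ i j => (contDiff_fluxCorrector hA hχ α γ i j).continuous)
    exact ⟨K, h ε⟩
  choose Kr hKr using hKr
  choose Kχ hKχ using hKχ
  obtain ⟨Kb, hKb⟩ := hKb
  have hw := memH1_firstCorrector hΩ hχ hu₀ ε
  have hφ := memH1_testFunction φ
  have hφ' : MemL2Field Ω fun α => pd α φ := fun α => (hasWeakDeriv_testFunction φ α).memLp_deriv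
  have hφae : ∀ α, weakGrad Ω φ α =ᵐ[volume.restrict (Ω : Set Plane)] pd α φ := fun α =>
    (hasWeakDeriv_testFunction φ α).weakDeriv_ae_eq
  have hwae : ∀ α, weakGrad Ω (firstCorrector Ω χ ε u₀) α
      =ᵐ[volume.restrict (Ω : Set Plane)] firstCorrectorDeriv Ω χ ε u₀ α := fun α =>
    (hasWeakDeriv_firstCorrector hΩ hχ hu₀ ε α).weakDeriv_ae_eq
  have hwL2 : MemL2Field Ω (firstCorrectorDeriv Ω χ ε u₀) := fun α =>
    (hasWeakDeriv_firstCorrector hΩ hχ hu₀ ε α).memLp_deriv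
  have hd : ∀ γ, MemL2Field Ω (weakGrad Ω (weakDeriv Ω γ u₀)) := fun γ => (hu₀.2 γ).memL2Field
  have hFχ : ∀ γ ∈ Finset.univ, MemL2Field Ω (flux (oscillating (fun y α β => A y α β * χ γ y) ε)
      (weakGrad Ω (weakDeriv Ω γ u₀))) := fun γ _ => (hKχ γ).memL2Field_flux (hd γ)
  have e1 : energyForm Ω (oscillating A ε) (remainder Ω χ ε u₀ u ϑ) φ
      = energyForm Ω (homogenized A χ) u₀ φ - energyForm Ω (oscillating A ε) u₀ φ
        - ε * energyForm Ω (oscillating A ε) (firstCorrector Ω χ ε u₀) φ := by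
    unfold remainder
    rw [energyForm_sub_left (hK ε) ((hu.sub hu₀.1).sub (hw.const_smul ε)) (hϑ.const_smul ε) hφ,
      energyForm_sub_left (hK ε) (hu.sub hu₀.1) (hw.const_smul ε) hφ,
      energyForm_sub_left (hK ε) hu hu₀.1 hφ, energyForm_smul_left _ _ hw,
      energyForm_smul_left _ _ hϑ, hϑeq, heq, mul_zero, sub_zero]
  have e2 : energyForm Ω (homogenized A χ) u₀ φ - energyForm Ω (oscillating A ε) u₀ φ
        - ε * energyForm Ω (oscillating A ε) (firstCorrector Ω χ ε u₀) φ
      = pairing Ω (flux (homogenized A χ) (weakGrad Ω u₀) - flux (oscillating A ε) (weakGrad Ω u₀)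
        - ε • flux (oscillating A ε) (firstCorrectorDeriv Ω χ ε u₀)) (fun α => pd α φ) := by
    rw [pairing_sub_left ((hK₀.memL2Field_flux hu₀.1.memL2Field).sub
        ((hK ε).memL2Field_flux hu₀.1.memL2Field))
        (((hK ε).memL2Field_flux hwL2).const_smul ε) hφ',
      pairing_sub_left (hK₀.memL2Field_flux hu₀.1.memL2Field)
        ((hK ε).memL2Field_flux hu₀.1.memL2Field) hφ', pairing_smul_left]
    simp only [energyForm_eq_pairing]
    rw [pairing_congr (fun _ => Filter.EventuallyEq.rfl) hφae,
      pairing_congr (p := flux (oscillating A ε) (weakGrad Ω u₀))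
        (fun _ => Filter.EventuallyEq.rfl) hφae,
      pairing_congr (flux_congr _ hwae) hφae]
  have e3 : pairing Ω (remainderFlux Ω A χ Ψ ε u₀) (weakGrad Ω φ)
      = (∑ γ, pairing Ω (flux (oscillating (fun y α β => rotation α β • Ψ γ y) ε)
          (weakGrad Ω (weakDeriv Ω γ u₀))) (fun α => pd α φ))
        - ∑ γ, pairing Ω (flux (oscillating (fun y α β => A y α β * χ γ y) ε)
          (weakGrad Ω (weakDeriv Ω γ u₀))) (fun α => pd α φ) := by
    have hsplit : ∀ γ, flux (oscillating (remainderCoeff A χ Ψ γ) ε)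
        (weakGrad Ω (weakDeriv Ω γ u₀))
        = flux (oscillating (fun y α β => rotation α β • Ψ γ y) ε)
          (weakGrad Ω (weakDeriv Ω γ u₀))
        - flux (oscillating (fun y α β => A y α β * χ γ y) ε)
          (weakGrad Ω (weakDeriv Ω γ u₀)) := fun γ =>
      flux_sub_coeff (oscillating (fun y α β => rotation α β • Ψ γ y) ε)
        (oscillating (fun y α β => A y α β * χ γ y) ε) _
    rw [pairing_congr (fun _ => Filter.EventuallyEq.rfl) hφae, remainderFlux]
    simp only [hsplit]
    rw [pairing_sum_left (fun γ _ => ((hKr γ).memL2Field_flux (hd γ)).sub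
      ((hKχ γ).memL2Field_flux (hd γ))) hφ', ← Finset.sum_sub_distrib]
    exact Finset.sum_congr rfl fun γ _ => pairing_sub_left ((hKr γ).memL2Field_flux (hd γ))
      ((hKχ γ).memL2Field_flux (hd γ)) hφ'
  rw [e1, e2, e3, flux_homogenized_sub hε, pairing_sub_left
    ((hKb.memL2Field_flux hu₀.1.memL2Field).const_smul (-1))
    ((MemL2Field.sum hFχ).const_smul ε) hφ', pairing_smul_left, pairing_smul_left,
    pairing_sum_left hFχ hφ', pairing_fluxCorrector hΩ hu₀ hε hΨ h1 h0]
  ring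

lemma energyForm_coercive {lam : ℝ}
    (hell : ∀ (y : Plane) (ξ : Fin 2 → Vec N),
      lam * ∑ α, ‖ξ α‖ ^ 2 ≤ ∑ α, ∑ β, ∑ i, ∑ j, A y α β i j * ξ α i * ξ β j)
    {K : ℝ} (hK : IsBoundedCoeff (oscillating A ε) K) {r : Plane → Vec N} (hr : MemH1 Ω r) :
    lam * fieldNorm Ω (weakGrad Ω r) ^ 2 ≤ energyForm Ω (oscillating A ε) r r := by
  have hi : Integrable (fun x => ∑ α, ‖weakGrad Ω r α x‖ ^ 2)
      (volume.restrict (Ω : Set Plane)) :=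
    integrable_finsetSum _ fun α _ => integrable_norm_sq (hr.memLp_weakDeriv α)
  rw [energyForm_eq_pairing, fieldNorm_sq,
    ← integral_finsetSum _ fun α _ => integrable_norm_sq (hr.memL2Field α), ← integral_const_mul]
  refine integral_mono (hi.const_mul lam)
    ((hK.memL2Field_flux hr.memL2Field).integrable_pairing hr.memL2Field) fun x => ?_
  -- Ellipticity holds for all `ξ`, so it can be used pointwise with `ξ α = ∂_α r(x)` and
  -- integrated.
  refine (hell (ε⁻¹ • x) fun α => weakGrad Ω r α x).trans_eq ?_
  refine Finset.sum_congr rfl fun α _ => ?_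
  rw [Finset.sum_comm]
  refine Finset.sum_congr rfl fun i _ => ?_
  simp only [flux_apply, Finset.sum_mul, oscillating]
  exact Finset.sum_congr rfl fun β _ => Finset.sum_congr rfl fun j _ => by ring

lemma abs_pairing_remainderFlux_le {K : ℝ} (hK0 : 0 ≤ K)
    (hK : ∀ γ, IsBoundedCoeff (oscillating (remainderCoeff A χ Ψ γ) ε) K) (hu₀ : MemH2 Ω u₀)
    {q : Fin 2 → Plane → Vec N} (hq : MemL2Field Ω q) :
    |pairing Ω (remainderFlux Ω A χ Ψ ε u₀) q|
      ≤ 4 * N ^ 2 * K * h2Norm Ω u₀ * fieldNorm Ω q := by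
  have hF := fun γ => (hK γ).memL2Field_flux (hu₀.2 γ).memL2Field
  rw [remainderFlux, pairing_sum_left (fun γ _ => hF γ) hq]
  have : ∀ γ ∈ Finset.univ, |pairing Ω (flux (oscillating (remainderCoeff A χ Ψ γ) ε)
      (weakGrad Ω (weakDeriv Ω γ u₀))) q| ≤ 2 * N ^ 2 * K * h2Norm Ω u₀ * fieldNorm Ω q := by
    intro γ _
    refine (abs_pairing_le (hF γ) hq).trans (mul_le_mul_of_nonneg_right ?_ (fieldNorm_nonneg q))
    exact (fieldNorm_flux_le (hK γ) hK0 (hu₀.2 γ).memL2Field).trans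
      (mul_le_mul_of_nonneg_left (fieldNorm_weakGrad_weakDeriv_le u₀ γ) (by positivity))
  refine (Finset.abs_sum_le_sum_abs _ _).trans ((Finset.sum_le_card_nsmul _ _ _ this).trans_eq ?_)
  simp only [Finset.card_univ, Fintype.card_fin, nsmul_eq_mul]
  push_cast
  ring

/-- Rescaling does not change the supremum of a continuous periodic function; this makes the final
constant independent of `ε`. -/
lemma exists_remainderCoeff_bound (hAp : IsPeriodic A) (hA : IsSmoothCoeff A)
    (hχ : IsCellCorrector A χ) (hΨ : ∀ γ i j, ContDiff ℝ 1 fun y => Ψ γ y i j)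
    (hΨp : ∀ γ i j, IsPeriodic fun y => Ψ γ y i j) :
    ∃ K, 0 ≤ K ∧ ∀ γ ε, IsBoundedCoeff (oscillating (remainderCoeff A χ Ψ γ) ε) K := by
  have : ∀ γ, ∃ K, 0 ≤ K ∧ ∀ ε, IsBoundedCoeff (oscillating (remainderCoeff A χ Ψ γ) ε) K := by
    intro γ
    refine exists_isBoundedCoeff (fun y l => ?_) fun α β i j => ?_
    · funext α β
      ext i j
      simp only [remainderCoeff, Matrix.sub_apply, Matrix.smul_apply, hΨp γ i j y l, hAp y l,
        hχ.periodic γ y l]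
    · simp only [remainderCoeff, Matrix.sub_apply, Matrix.smul_apply, smul_eq_mul,
        Matrix.mul_apply]
      exact (continuous_const.mul (hΨ γ i j).continuous).sub (continuous_finsetSum _ fun k _ =>
        (hA α β i k).continuous.mul (hχ.contDiff γ k j).continuous)
  choose K hK0 hK using this
  refine ⟨∑ γ, K γ, Finset.sum_nonneg fun γ _ => hK0 γ, fun γ ε => ⟨(hK γ ε).continuous, ?_⟩⟩
  intro x α β i j
  exact ((hK γ ε).bound x α β i j).trans
    (Finset.single_le_sum (fun γ _ => hK0 γ) (Finset.mem_univ γ))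

/-- The remainder is `(u - φ₀) - (u₀ - φ₀) - ε(ϑ + u¹)`, a combination of three functions with zero
trace. -/
lemma memH10_remainder {f : (Plane → Vec N) → ℝ} {φ₀ : Plane → Vec N} (hε : ε ≠ 0)
    {B : Coeff N} (hu₀ : IsWeakSolution Ω B f φ₀ u₀)
    (hu : IsWeakSolution Ω (oscillating A ε) f φ₀ u)
    (hϑ : IsWeakSolution Ω (oscillating A ε) (fun _ => 0)
      (fun x => -firstCorrector Ω χ ε u₀ x) ϑ) :
    MemH10 Ω (remainder Ω χ ε u₀ u ϑ) := by
  have := (hu.boundary.sub hu₀.boundary).sub (hϑ.boundary.const_smul hε)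
  convert this using 1
  funext x
  simp only [remainder]
  module

end Estimate

end Homogenization

end

/-! ### The main estimate. -/

theorem proposition2p1 (N : ℕ) (Ω : TopologicalSpace.Opens Homogenization.Plane)
    (hΩ : Bornology.IsBounded (Ω : Set Homogenization.Plane))
    (A : Homogenization.Coeff N)
    (hA_ell : Homogenization.IsElliptic A)
    (hA_per : Homogenization.IsPeriodic A)
    (hA_smooth : Homogenization.IsSmoothCoeff A)
    (χ : Fin 2 → Homogenization.Plane → Matrix (Fin N) (Fin N) ℝ)
    (hχ : Homogenization.IsCellCorrector A χ) :
    ∃ C : ℝ, 0 < C ∧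
      ∀ (f : (Homogenization.Plane → Homogenization.Vec N) → ℝ)
        (φ₀ u₀ : Homogenization.Plane → Homogenization.Vec N),
        Homogenization.MemHMinusOne Ω f →
        Homogenization.MemH1 Ω φ₀ →
        Homogenization.IsWeakSolution Ω (Homogenization.homogenized A χ) f φ₀ u₀ →
        Homogenization.MemH2 Ω u₀ →
        ∀ (ε : ℝ), 0 < ε →
        ∀ (u ϑ : Homogenization.Plane → Homogenization.Vec N),
          Homogenization.IsWeakSolution Ω (Homogenization.oscillating A ε) f φ₀ u →
          Homogenization.IsWeakSolution Ω (Homogenization.oscillating A ε) (fun _ => 0)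
            (fun x => -Homogenization.firstCorrector Ω χ ε u₀ x) ϑ →
          Homogenization.MemH1 Ω (fun x => u x - u₀ x
              - ε • Homogenization.firstCorrector Ω χ ε u₀ x - ε • ϑ x) ∧
          Homogenization.h1Norm Ω (fun x => u x - u₀ x
              - ε • Homogenization.firstCorrector Ω χ ε u₀ x - ε • ϑ x)
            ≤ C * ε * Homogenization.h2Norm Ω u₀ := by

  open Homogenization in
  obtain ⟨lam, hlam, hell⟩ := hA_ell
  obtain ⟨Ψ, hΨ, hΨp, h1, h0⟩ := exists_flux_potential hA_per hA_smooth hχ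
  obtain ⟨K, hK0, hK⟩ := exists_remainderCoeff_bound hA_per hA_smooth hχ hΨ hΨp
  obtain ⟨KA, -, hKA⟩ := exists_isBoundedCoeff hA_per fun α β i j => (hA_smooth α β i j).continuous
  obtain ⟨P, hP0, hP⟩ := exists_poincare N hΩ
  -- The factor `lam⁻¹ * (4 * N ^ 2 * K)` bounds the gradient by energy, `√(P + 1)` comes from
  -- Poincaré's inequality, and `+ 1` ensures positivity even when `K = 0`.
  refine ⟨Real.sqrt (P + 1) * (lam⁻¹ * (4 * N ^ 2 * K)) + 1, by positivity, ?_⟩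
  intro f φ₀ u₀ _ _ hu₀ hu₀2 ε hε u ϑ hu hϑ
  change MemH1 Ω (remainder Ω χ ε u₀ u ϑ) ∧ h1Norm Ω (remainder Ω χ ε u₀ u ϑ) ≤ _
  have hr : MemH10 Ω (remainder Ω χ ε u₀ u ϑ) := memH10_remainder hε.ne' hu₀ hu hϑ
  refine ⟨hr.1, ?_⟩
  set r := remainder Ω χ ε u₀ u ϑ with hrdef
  set F := remainderFlux Ω A χ Ψ ε u₀ with hF
  have hFL2 : MemL2Field Ω F := MemL2Field.sum fun γ _ =>
    (hK γ ε).memL2Field_flux (hu₀2.2 γ).memL2Field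
  have hfl : MemL2Field Ω (flux (oscillating A ε) (weakGrad Ω r)) :=
    (hKA ε).memL2Field_flux hr.1.memL2Field
  have hGL2 := hfl.sub (hFL2.const_smul ε)
  -- The field `A(x/ε)∇r - εF` annihilates gradients of test functions, hence also `∇r`.
  have key := pairing_eq_zero_of_testFunction hGL2 (fun φ => by
    have hφ := memH10_testFunction φ
    rw [pairing_sub_left hfl (hFL2.const_smul ε) hφ.1.memL2Field, pairing_smul_left,
      ← energyForm_eq_pairing, energyForm_remainder hΩ hA_per hA_smooth hχ hu₀2 hε.ne' hΨ hΨp h1 h0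
        hu.memH1 hϑ.memH1 φ ((hu.weak _ hφ).trans (hu₀.weak _ hφ).symm) (hϑ.weak _ hφ), sub_self])
    hr
  rw [pairing_sub_left hfl (hFL2.const_smul ε) hr.1.memL2Field, pairing_smul_left,
    ← energyForm_eq_pairing, sub_eq_zero] at key
  have hcoer := energyForm_coercive (Ω := Ω) (fun y ξ => (hell y ξ).1) (hKA ε) hr.1
  have hbd := (le_abs_self _).trans
    (abs_pairing_remainderFlux_le hK0 (fun γ => hK γ ε) hu₀2 hr.1.memL2Field)
  set g := fieldNorm Ω (weakGrad Ω r) with hg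
  have hg0 : 0 ≤ g := fieldNorm_nonneg _
  have hh2 : 0 ≤ h2Norm Ω u₀ := Real.sqrt_nonneg _
  have hgle : g ≤ lam⁻¹ * (4 * N ^ 2 * K) * ε * h2Norm Ω u₀ := by
    -- The energy inequality is quadratic in `g` on the left and linear on the right, so one factor
    -- `g` is divided out, which requires `g ≠ 0`.
    rcases hg0.eq_or_lt with h | h
    · rw [← h]
      positivity
    · have h2 : lam * g ^ 2 ≤ ε * (4 * N ^ 2 * K * h2Norm Ω u₀ * g) :=
        hcoer.trans (key.trans_le (mul_le_mul_of_nonneg_left hbd hε.le))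
      have h3 : lam * g ≤ ε * (4 * N ^ 2 * K * h2Norm Ω u₀) := by
        refine le_of_mul_le_mul_right ?_ h
        linarith
      calc g = lam⁻¹ * (lam * g) := by rw [← mul_assoc, inv_mul_cancel₀ hlam.ne', one_mul]
        _ ≤ lam⁻¹ * (ε * (4 * N ^ 2 * K * h2Norm Ω u₀)) :=
          mul_le_mul_of_nonneg_left h3 (inv_nonneg.2 hlam.le)
        _ = _ := by ring
  have hsq : h1Norm Ω r ^ 2 ≤ (P + 1) * g ^ 2 := by
    rw [h1Norm_sq]
    linarith [hP r hr]
  have hle : h1Norm Ω r ≤ Real.sqrt (P + 1) * g := by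
    refine abs_le_of_sq_le_sq' ?_ (by positivity) |>.2
    rwa [mul_pow, Real.sq_sqrt (by positivity)]
  refine hle.trans ((mul_le_mul_of_nonneg_left hgle (Real.sqrt_nonneg _)).trans ?_)
  have : 0 ≤ ε * h2Norm Ω u₀ := by positivity
  linarith
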